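/- **Topological notions.** For a topological space $(X,\tau)$ let $d_\tau(A)$ be the set of limit points of $A\subseteq X$. The space is *scattered* if every nonempty subspace has an isolated point. For a scattered space put $d^0X=X$, $d^{\alpha+1}X=d_\tau(d^\alpha X)$, $d^\alpha X=\bigcap_{\beta<\alpha}d^\beta X$ for limit $\alpha$, and let $\rho_\tau(x)=\min\{\alpha: x\notin d^{\alpha+1}X\}$. A topology $\sigma\supseteq\tau$ on $X$ is an *$\ell$-extension* of $\tau$ if $\rho_\sigma=\rho_\tau$ and, for every $U\in\sigma$ and every $x\in U$ such that $\rho_\tau(x)$ is not a limit ordinal, there is $V\in\tau$ with $x\in V\subseteq U$. A topology is *$\ell$-maximal* if it has no proper $\ell$-extension. Let $\tau^+$ be the topology generated by $\tau\cup\{d_\tau(A):A\subseteq X\}$. A space $(X,\tau_0,\dots,\tau_n)$ is an *lme-space based on* a scattered topology $\tau$ if $\tau_0$ is an $\ell$-maximal $\ell$-extension of $\tau$ and, for each $i<n$, $\tau_{i+1}$ is an $\ell$-maximal $\ell$-extension of $\tau_i^+$. For an ordinal $\lambda$, $([1,\lambda],\tau_0,\dots,\tau_n)$ is an *ordinal lme-space*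 if it is an lme-space based on the order topology of the interval of ordinals $[1,\lambda]$. A *$\mathrm{GLP}_n$-space* is a space $(X,\tau_0,\dots,\tau_n)$ in which all $\tau_i$ are scattered and, for $i<n$, $\tau_i\subseteq\tau_{i+1}$ and $d_{\tau_i}(A)\in\tau_{i+1}$ for all $A\subseteq X$ (every lme-space is one). A *$d$-map* is a continuous open map all of whose fibres are discrete subspaces. **$J_n$-trees.** Let $T=(T,R_0,\dots,R_n)$ be a set with binary relations. It is a *$J_n$-frame* if each $R_k$ is transitive and dually well-founded and, for $m<k$: if $xR_ky$ then ($xR_mz$ iff $yR_mz$); and $xR_my$, $yR_kz$ imply $xR_mz$. Write $R_k^*=R_k\cup\dots\cup R_n$ (so $R^*_{n+1}=\emptyset$). A *$k$-sheet* is a class of the equivalence relation generated by $R_k^*$; for $(k+1)$-sheets $\alpha,\beta$ write $\alpha R_k\beta$ if $xR_ky$ for some $x\in\alpha$, $y\in\beta$. A finite $J_n$-frame $T$ is a *finite $J_n$-tree* if, for each $k\le n$, the $(k+1)$-sheets contained in any given $k$-sheet form a tree under $R_k$ (a strict partial order with a root below all other elements, in which the predecessors of each element are linearly ordered), and $\alpha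 R_k\beta$ implies $xR_ky$ for all $x\in\alpha$, $y\in\beta$. A point $w$ is a *hereditary $k$-root* if $vR_jw$ holds for no $v\in T$ and no $j\ge k$. **$J_n$-morphisms.** Let $\sigma_k$ be the topology on $T$ whose open sets are the $R_k$-upsets. A map $f:X\to T$ from a $\mathrm{GLP}_n$-space $X=(X,\tau_0,\dots,\tau_n)$ is a *$J_n$-morphism* if 1. $f:(X,\tau_n)\to(T,\sigma_n)$ is a $d$-map; 2. $f:(X,\tau_k)\to(T,\sigma_k)$ is open for all $k\le n$; 3. for each $k<n$ and each hereditary $(k+1)$-root $w$, the sets $f^{-1}(R_k^*(w))$ and $f^{-1}(R_k^*(w)\cup\{w\})$ are $\tau_k$-open; 4. for each $k<n$ and each hereditary $(k+1)$-root $w$, $f^{-1}(w)$ is a discrete subspace of $(X,\tau_k)$. **Lemma.** For each $n\geq 0$ and each finite $J_n$-tree $T$ there exist an ordinal $\lambda<\varepsilon_0$, an ordinal lme-space $X=([1,\lambda],\tau_0,\dots,\tau_n)$ and a surjective $J_n$-morphism $f:X\to T$. -/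

import Mathlib

open scoped Topology Ordinal

universe u v

namespace GLPSpaces

section Topology

variable {X : Type u} {Y : Type v}

/-- `(X, τ)` is scattered: every nonempty subspace has an isolated point. -/
def IsScattered (τ : TopologicalSpace X) : Prop :=
  ∀ A : Set X, A.Nonempty → ∃ x ∈ A, ∃ U : Set X, IsOpen[τ] U ∧ U ∩ A = {x}

/-- The `α`-th term `d^α X` of the Cantor–Bendixson sequence of the whole space `(X, τ)`.
(All terms are closed, so the relative derived set in Mathlib's definition is the derived set.) -/
def cbDeriv (τ : TopologicalSpace X) (α : Ordinal.{u}) : Set X :=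
  @CantorBendixson.iteratedDerivedSet X τ Set.univ α

/-- The rank function `ρ_τ(x) = min {α : x ∉ d^(α+1) X}`. -/
noncomputable def rank (τ : TopologicalSpace X) (x : X) : Ordinal.{u} :=
  sInf {α : Ordinal.{u} | x ∉ cbDeriv τ (α + 1)}

/-- `σ` is a rank preserving extension of `τ`; `σ ≤ τ` says that every `τ`-open set is
`σ`-open. -/
structure IsRankPreservingExtension (τ σ : TopologicalSpace X) : Prop where
  extends_base : σ ≤ τ
  rank_eq : ∀ x, rank σ x = rank τ x

/-- `σ` is an `ℓ`-extension of `τ`. -/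
structure IsLExtension (τ σ : TopologicalSpace X) : Prop
    extends IsRankPreservingExtension τ σ where
  nhds_of_not_limit : ∀ U : Set X, IsOpen[σ] U → ∀ x ∈ U, ¬ Order.IsSuccLimit (rank τ x) →
    ∃ V : Set X, IsOpen[τ] V ∧ x ∈ V ∧ V ⊆ U

/-- `(X, τ)` is `ℓ`-maximal: it has no proper `ℓ`-extension. -/
def IsLMaximal (τ : TopologicalSpace X) : Prop :=
  ∀ σ : TopologicalSpace X, IsLExtension τ σ → σ = τ

/-- `σ` is an `ℓ`-maximal `ℓ`-extension of `τ`. -/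
def IsLMaximalLExtension (τ σ : TopologicalSpace X) : Prop :=
  IsLExtension τ σ ∧ IsLMaximal σ

/-- The next topology `τ⁺`, generated by `τ` and all sets `d_τ(A)`. -/
@[reducible] def nextTopology (τ : TopologicalSpace X) : TopologicalSpace X :=
  TopologicalSpace.generateFrom
    ({U : Set X | IsOpen[τ] U} ∪ Set.range fun A : Set X => @derivedSet X τ A)

/-- `(X, τ₀, …, τₙ)` is a GLPₙ-space. -/
structure IsGLPSpace {n : ℕ} (τ : Fin (n + 1) → TopologicalSpace X) : Prop where
  scattered : ∀ k, IsScattered (τ k)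
  mono : ∀ k : Fin n, ∀ U : Set X, IsOpen[τ k.castSucc] U → IsOpen[τ k.succ] U
  derived_open : ∀ k : Fin n, ∀ A : Set X, IsOpen[τ k.succ] (@derivedSet X (τ k.castSucc) A)

/-- `(X, τ₀, …, τₙ)` is an lme-space based on the scattered topology `τ`. -/
structure IsLMESpace {n : ℕ} (base : TopologicalSpace X)
    (τ : Fin (n + 1) → TopologicalSpace X) : Prop where
  scattered_base : IsScattered base
  zero : IsLMaximalLExtension base (τ 0)
  succ : ∀ k : Fin n, IsLMaximalLExtension (nextTopology (τ k.castSucc)) (τ k.succ)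

/-- `([1, lam], τ₀, …, τₙ)` is an ordinal lme-space: it is based on the order topology. -/
def IsOrdinalLMESpace {n : ℕ} (lam : Ordinal.{u})
    (τ : Fin (n + 1) → TopologicalSpace (Set.Icc 1 lam)) : Prop :=
  IsLMESpace (Preorder.topology (Set.Icc 1 lam)) τ

/-- A `d`-map: continuous, open and pointwise discrete. -/
structure IsDMap (τ : TopologicalSpace X) (σ : TopologicalSpace Y) (f : X → Y) : Prop where
  continuous : Continuous[τ, σ] f
  isOpenMap : @IsOpenMap X Y τ σ f
  discrete_fiber : ∀ y, @IsDiscrete X τ (f ⁻¹' {y})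

end Topology

section Frames

variable {T : Type v} {n : ℕ}

/-- The union `R_k ∪ R_{k+1} ∪ … ∪ R_n`; on J-frames this relation is transitive. For `k = n + 1`
it is empty. -/
def RStar (R : Fin (n + 1) → T → T → Prop) (k : ℕ) (x y : T) : Prop :=
  ∃ i : Fin (n + 1), k ≤ (i : ℕ) ∧ R i x y

/-- `S` is a `k`-sheet: a class of the equivalence relation generated by
`R_k ∪ R_{k+1} ∪ … ∪ R_n`. -/
def IsSheet (R : Fin (n + 1) → T → T → Prop) (k : ℕ) (S : Set T) : Prop :=
  ∃ x, S = {y | Relation.EqvGen (RStar R k) x y}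

/-- The relation induced by `R_k` on sets of points: some point of `A` is `R_k`-related to some
point of `B`. -/
def SheetRel (R : Fin (n + 1) → T → T → Prop) (k : Fin (n + 1)) (A B : Set T) : Prop :=
  ∃ x ∈ A, ∃ y ∈ B, R k x y

/-- `P` is a (finite) tree under the strict order `lt`: there is a root below everything else,
and the predecessors of each element are linearly ordered. -/
structure IsTreeUnder {α : Type v} (P : Set α) (lt : α → α → Prop) : Prop where
  irrefl : ∀ a ∈ P, ¬ lt a a
  trans : ∀ a ∈ P, ∀ b ∈ P, ∀ c ∈ P, lt a b → lt b c → lt a c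
  root : ∃ r ∈ P, ∀ a ∈ P, a = r ∨ lt r a
  linear : ∀ a ∈ P, ∀ b ∈ P, ∀ c ∈ P, lt a c → lt b c → lt a b ∨ a = b ∨ lt b a

/-- `(T, R_0, …, R_n)` is a `J_n`-frame. -/
structure IsJFrame (R : Fin (n + 1) → T → T → Prop) : Prop where
  trans : ∀ k x y z, R k x y → R k y z → R k x z
  dually_wf : ∀ k, WellFounded (Function.swap (R k))
  stable : ∀ m k, m < k → ∀ x y z, R k x y → (R m x z ↔ R m y z)
  absorb : ∀ m k, m < k → ∀ x y z, R m x y → R k y z → R m x z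

/-- `(T, R_0, …, R_n)` is a tree-like `J_n`-frame, or `J_n`-tree: for each `k`, the
`(k+1)`-sheets contained in a `k`-sheet form a tree under `R_k`, and if two `(k+1)`-sheets are
`R_k`-related, then all their points are. -/
structure IsJTree (R : Fin (n + 1) → T → T → Prop) : Prop extends IsJFrame R where
  tree : ∀ (k : Fin (n + 1)) (S : Set T), IsSheet R (k : ℕ) S →
    IsTreeUnder {A : Set T | IsSheet R ((k : ℕ) + 1) A ∧ A ⊆ S} (SheetRel R k)
  uniform : ∀ (k : Fin (n + 1)) (A B : Set T), IsSheet R ((k : ℕ) + 1) A → IsSheet R ((k : ℕ) + 1) B →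
    SheetRel R k A B → ∀ x ∈ A, ∀ y ∈ B, R k x y

/-- `w` is a hereditary `k`-root. -/
def IsHereditaryRoot (R : Fin (n + 1) → T → T → Prop) (k : ℕ) (w : T) : Prop :=
  ∀ j : Fin (n + 1), k ≤ (j : ℕ) → ∀ v, ¬ R j v w

/-- The topology whose open sets are the upsets of a binary relation. -/
@[reducible] def upsetTopology (r : T → T → Prop) : TopologicalSpace T where
  IsOpen U := ∀ x ∈ U, ∀ y, r x y → y ∈ U
  isOpen_univ := fun _ _ _ _ => trivial
  isOpen_inter := fun _ _ hU hV x hx y hxy => ⟨hU x hx.1 y hxy, hV x hx.2 y hxy⟩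
  isOpen_sUnion := fun _ h x ⟨U, hU, hx⟩ y hxy => ⟨U, hU, h U hU x hx y hxy⟩

/-- `f` is a `J_n`-morphism from the GLPₙ-space `(X, τ₀, …, τₙ)` to `(T, R_0, …, R_n)`. -/
structure IsJMorphism {X : Type u} (τ : Fin (n + 1) → TopologicalSpace X)
    (R : Fin (n + 1) → T → T → Prop) (f : X → T) : Prop where
  glp : IsGLPSpace τ
  j1 : IsDMap (τ (Fin.last n)) (upsetTopology (R (Fin.last n))) f
  j2 : ∀ k, @IsOpenMap X T (τ k) (upsetTopology (R k)) f
  j3 : ∀ k : Fin n, ∀ w, IsHereditaryRoot R ((k : ℕ) + 1) w →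
    IsOpen[τ k.castSucc] (f ⁻¹' {v | RStar R (k : ℕ) w v}) ∧
    IsOpen[τ k.castSucc] (f ⁻¹' ({v | RStar R (k : ℕ) w v} ∪ {w}))
  j4 : ∀ k : Fin n, ∀ w, IsHereditaryRoot R ((k : ℕ) + 1) w →
    @IsDiscrete X (τ k.castSucc) (f ⁻¹' {w})

end Frames

end GLPSpaces

/-!
Induct on the tree. A disjoint union of two upsets is realized by concatenating two intervals, so
that the essential case is a cone, consisting of a `(k + 1)`-sheet and of all the points above it.
Given a realization of the points above on `[1, μ]` and one of the sheet on `[1, 1 + κ]`, take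
`ω ^ κ` blocks, each made of `ω` copies of `[1, μ]`. The end points of the blocks form a closed set,
on which the rank, increased by `1`, takes values in `[1, 1 + κ]`; the rest is mapped to `[1, μ]` by
folding all the copies onto one.

The topologies are lifted from `[1, μ]` and `[1, 1 + κ]` by means of `ℓ`-maximality. A `d`-map to an
`ℓ`-maximal space remains a `d`-map under `ℓ`-extensions of its domain. For an `ℓ`-maximal topology
`τ`, the topology `τ⁺` is the join of `τ` and the order topology pulled back along the rank
function. Hence `d`-maps between `ℓ`-maximal spaces pass to next topologies, the set of end points
is open in the next topology, and there its rank function is a `d`-map onto `[1, 1 + κ]`.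
-/

universe w w'

namespace GLPSpaces

variable {X : Type u} {Y : Type v}

lemma mem_derivedSet_iff_open {τ : TopologicalSpace X} {A : Set X} {x : X} :
    x ∈ @derivedSet X τ A ↔ ∀ U, IsOpen[τ] U → x ∈ U → ∃ y ∈ U, y ∈ A ∧ y ≠ x := by
  rw [mem_derivedSet, accPt_iff_nhds]
  refine ⟨fun h U hU hx => ?_, fun h U hU => ?_⟩
  · obtain ⟨y, hy, hne⟩ := h U (hU.mem_nhds hx)
    exact ⟨y, hy.1, hy.2, hne⟩
  · obtain ⟨V, hVU, hV, hx⟩ := mem_nhds_iff.1 hU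
    obtain ⟨y, hy, hA, hne⟩ := h V hV hx
    exact ⟨y, ⟨hVU hy, hA⟩, hne⟩

lemma notMem_derivedSet_iff_open {τ : TopologicalSpace X} {A : Set X} {x : X} :
    x ∉ @derivedSet X τ A ↔ ∃ U, IsOpen[τ] U ∧ x ∈ U ∧ ∀ y ∈ U, y ∈ A → y = x := by
  rw [mem_derivedSet_iff_open]
  push Not
  rfl

lemma isOpen_of_forall_exists_subset {τ : TopologicalSpace X} {U : Set X}
    (h : ∀ x ∈ U, ∃ V, IsOpen[τ] V ∧ x ∈ V ∧ V ⊆ U) : IsOpen[τ] U :=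
  isOpen_iff_forall_mem_open.2 fun x hx =>
    let ⟨V, hV, hxV, hVU⟩ := h x hx
    ⟨V, hVU, hV, hxV⟩

lemma isDiscrete_iff_isolated {τ : TopologicalSpace X} {s : Set X} :
    @IsDiscrete X τ s ↔ ∀ x ∈ s, ∃ U, IsOpen[τ] U ∧ x ∈ U ∧ ∀ y ∈ U, y ∈ s → y = x := by
  rw [isDiscrete_iff_forall_mem_exists_isOpen]
  refine forall₂_congr fun x hx => exists_congr fun U => and_congr_right fun _ => ?_
  rw [Set.eq_singleton_iff_unique_mem]
  exact ⟨fun h => ⟨h.1.1, fun y hy hys => h.2 y ⟨hy, hys⟩⟩,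
    fun h => ⟨⟨h.1, hx⟩, fun y hy => h.2 y hy.1 hy.2⟩⟩

/-- `h` behaves as the Cantor–Bendixson rank of `τ`: locally, `h` is strictly maximal at every
point, and takes all smaller values in every neighbourhood. The values may be taken in any
well-order, which spares renormalizing `h` when passing to subspaces or to another universe. -/
structure IsRankFn {L : Type w} [Preorder L] (τ : TopologicalSpace X) (h : X → L) : Prop where
  lt : ∀ x, ∃ U, IsOpen[τ] U ∧ x ∈ U ∧ ∀ y ∈ U, y ≠ x → h y < h x
  hit : ∀ x U, IsOpen[τ] U → x ∈ U → ∀ β < h x, ∃ y ∈ U, h y = β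

namespace IsRankFn

variable {L : Type w} {τ : TopologicalSpace X}

lemma mem_derivedSet_iff [Preorder L] {h : X → L} (H : IsRankFn τ h) {α : L} {x : X} :
    x ∈ @derivedSet X τ {y | α ≤ h y} ↔ α < h x := by
  rw [mem_derivedSet_iff_open]
  refine ⟨fun hx => ?_, fun hα U hU hx => ?_⟩
  · obtain ⟨U, hU, hxU, hlt⟩ := H.lt x
    obtain ⟨y, hy, hα, hne⟩ := hx U hU hxU
    exact hα.trans_lt (hlt y hy hne)
  · obtain ⟨y, hy, rfl⟩ := H.hit x U hU hx α hα
    exact ⟨y, hy, le_refl (h y), fun e => hα.ne (congrArg h e)⟩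

lemma isScattered [Preorder L] [WellFoundedLT L] {h : X → L} (H : IsRankFn τ h) :
    IsScattered τ := by
  intro A hA
  obtain ⟨x, hx, hmin⟩ := (InvImage.wf h wellFounded_lt).has_min A hA
  obtain ⟨U, hU, hxU, hlt⟩ := H.lt x
  exact ⟨x, hx, U, hU, Set.eq_singleton_iff_unique_mem.2 ⟨⟨hxU, hx⟩,
    fun y hy => by_contra fun hne => hmin y hy.2 (hlt y hy.1 hne)⟩⟩

lemma isOpen_preimage [Preorder L] {h : X → L} (H : IsRankFn τ h) {s : Set L} (hs : IsLowerSet s) :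
    IsOpen[τ] (h ⁻¹' s) := by
  refine isOpen_of_forall_exists_subset fun x hx => ?_
  obtain ⟨U, hU, hxU, hlt⟩ := H.lt x
  refine ⟨U, hU, hxU, fun y hy => ?_⟩
  rcases eq_or_ne y x with rfl | hne
  · exact hx
  · exact hs (hlt y hy hne).le hx

lemma isOpen_lt [Preorder L] {h : X → L} (H : IsRankFn τ h) (α : L) :
    IsOpen[τ] {y | h y < α} :=
  H.isOpen_preimage (isLowerSet_Iio α)

lemma mem_cbDeriv_iff {h : X → Ordinal.{u}} (H : IsRankFn τ h) (α : Ordinal.{u}) (x : X) :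
    x ∈ cbDeriv τ α ↔ α ≤ h x := by
  unfold cbDeriv
  induction α using Ordinal.limitRecOn generalizing x with
  | zero => simp
  | add_one α ih =>
    have hset : CantorBendixson.iteratedDerivedSet Set.univ α = {y | α ≤ h y} := Set.ext ih
    rw [CantorBendixson.iteratedDerivedSet_succ, relDerivedSet_apply, hset, Set.mem_inter_iff,
      H.mem_derivedSet_iff, Order.add_one_le_iff]
    exact ⟨fun h => h.1, fun h => ⟨h, h.le⟩⟩
  | limit α hα ih =>
    simp only [CantorBendixson.iteratedDerivedSet_limit hα, Set.mem_iInter, Subtype.forall,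
      Set.mem_Iio]
    exact ⟨fun hx => (hα.le_iff_forall_le).2 fun b hb => (ih b hb x).1 (hx b hb),
      fun hx b hb => (ih b hb x).2 (hb.le.trans hx)⟩

lemma rank_eq {h : X → Ordinal.{u}} (H : IsRankFn τ h) : rank τ = h := by
  funext x
  have hset : {α : Ordinal.{u} | x ∉ cbDeriv τ (α + 1)} = Set.Ici (h x) := by
    ext α
    simp [H.mem_cbDeriv_iff]
  rw [rank, hset, csInf_Ici]

end IsRankFn

lemma cbDeriv_antitone (τ : TopologicalSpace X) : Antitone (cbDeriv τ) :=
  CantorBendixson.iteratedDerivedSet_antitone Set.univ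

lemma cbDeriv_add_one (τ : TopologicalSpace X) (α : Ordinal.{u}) :
    cbDeriv τ (α + 1) = @derivedSet X τ (cbDeriv τ α) := by
  have hclosed : IsClosed (cbDeriv τ α) :=
    CantorBendixson.isClosed_iteratedDerivedSet isClosed_univ α
  rw [← hclosed.relDerivedSet_eq, cbDeriv, CantorBendixson.iteratedDerivedSet_succ]
  rfl

lemma mem_cbDeriv_of_le_rank {τ : TopologicalSpace X} {α : Ordinal.{u}} {x : X}
    (hα : α ≤ rank τ x) : x ∈ cbDeriv τ α := by
  have hlt : ∀ β < rank τ x, x ∈ cbDeriv τ (β + 1) := fun β hβ =>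
    by_contra fun hx => hβ.not_ge (csInf_le' hx)
  refine cbDeriv_antitone τ hα ?_
  rcases Ordinal.zero_or_succ_or_isSuccLimit (rank τ x) with h0 | ⟨β, hβ⟩ | hl
  · simp [h0, cbDeriv]
  · exact hβ ▸ hlt β (hβ ▸ Order.lt_succ β)
  · rw [cbDeriv, CantorBendixson.iteratedDerivedSet_limit hl]
    simp only [Set.mem_iInter, Subtype.forall, Set.mem_Iio]
    exact fun β hβ => cbDeriv_antitone τ (Order.le_succ β) (hlt β hβ)

namespace IsScattered

variable {τ : TopologicalSpace X}

lemma mono {σ : TopologicalSpace X} (hs : IsScattered τ) (h : σ ≤ τ) : IsScattered σ := by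
  intro A hA
  obtain ⟨x, hx, U, hU, e⟩ := hs A hA
  exact ⟨x, hx, U, h U hU, e⟩

lemma perfectKernel_univ (hs : IsScattered τ) :
    CantorBendixson.perfectKernel (Set.univ : Set X) = ∅ := by
  by_contra hne
  obtain ⟨x, hx, U, hU, hUx⟩ := hs _ (Set.nonempty_iff_ne_empty.2 hne)
  have hacc := (CantorBendixson.perfect_perfectKernel (X := X) isClosed_univ).acc x hx
  have hxU : x ∈ U := (hUx.symm.subset rfl).1
  obtain ⟨y, hy, hyne⟩ := accPt_iff_nhds.1 hacc U (hU.mem_nhds hxU)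
  exact hyne (hUx.subset hy)

lemma notMem_cbDeriv_rank_add_one (hs : IsScattered τ) (x : X) :
    x ∉ cbDeriv τ (rank τ x + 1) := by
  have hx : x ∉ CantorBendixson.perfectKernel (Set.univ : Set X) := by
    simp [hs.perfectKernel_univ]
  rw [CantorBendixson.perfectKernel, Set.mem_iInter, not_forall] at hx
  obtain ⟨α, hα⟩ := hx
  exact csInf_mem (s := {α | x ∉ cbDeriv τ (α + 1)})
    ⟨α, fun h => hα (cbDeriv_antitone τ (Order.le_succ α) h)⟩

lemma mem_cbDeriv_iff (hs : IsScattered τ) {α : Ordinal.{u}} {x : X} :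
    x ∈ cbDeriv τ α ↔ α ≤ rank τ x :=
  ⟨fun h => not_lt.1 fun hlt => hs.notMem_cbDeriv_rank_add_one x
    (cbDeriv_antitone τ (Order.add_one_le_of_lt hlt) h), mem_cbDeriv_of_le_rank⟩

lemma exists_isOpen_rank_lt (hs : IsScattered τ) (x : X) :
    ∃ U, IsOpen[τ] U ∧ x ∈ U ∧ ∀ y ∈ U, y ≠ x → rank τ y < rank τ x := by
  have hx := hs.notMem_cbDeriv_rank_add_one x
  rw [cbDeriv_add_one, notMem_derivedSet_iff_open] at hx
  obtain ⟨U, hU, hxU, h⟩ := hx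
  exact ⟨U, hU, hxU, fun y hy hne =>
    not_le.1 fun hle => hne (h y hy (mem_cbDeriv_of_le_rank hle))⟩

lemma exists_mem_rank_eq (hs : IsScattered τ) {x : X} {U : Set X} (hU : IsOpen[τ] U)
    (hx : x ∈ U) {β : Ordinal.{u}} (hβ : β < rank τ x) : ∃ y ∈ U, rank τ y = β := by
  induction hr : rank τ x using WellFoundedLT.induction generalizing x with
  | _ γ ih =>
    subst hr
    obtain ⟨V, hV, hxV, hlt⟩ := hs.exists_isOpen_rank_lt x
    have hmem : x ∈ cbDeriv τ (β + 1) := mem_cbDeriv_of_le_rank (Order.add_one_le_of_lt hβ)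
    rw [cbDeriv_add_one, mem_derivedSet_iff_open] at hmem
    obtain ⟨y, hy, hyβ, hne⟩ := hmem (U ∩ V) (hU.inter hV) ⟨hx, hxV⟩
    rcases (hs.mem_cbDeriv_iff.1 hyβ).eq_or_lt with e | hl
    · exact ⟨y, hy.1, e.symm⟩
    · exact ih _ (hlt y hy.2 hne) hy.1 hl rfl

lemma isRankFn (hs : IsScattered τ) : IsRankFn τ (rank τ) :=
  ⟨hs.exists_isOpen_rank_lt, fun _ _ hU hx _ hβ => hs.exists_mem_rank_eq hU hx hβ⟩

end IsScattered

lemma isDMap_iff {τ : TopologicalSpace X} {σ : TopologicalSpace Y} {f : X → Y} :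
    IsDMap τ σ f ↔ (∀ V, IsOpen[σ] V → IsOpen[τ] (f ⁻¹' V)) ∧
      (∀ U, IsOpen[τ] U → IsOpen[σ] (f '' U)) ∧
      ∀ x, ∃ U, IsOpen[τ] U ∧ x ∈ U ∧ ∀ y ∈ U, f y = f x → y = x :=
  ⟨fun ⟨hcont, hopen, hdisc⟩ => ⟨fun V hV => continuous_def.1 hcont V hV, hopen,
      fun x => isDiscrete_iff_isolated.1 (hdisc (f x)) x rfl⟩,
    fun ⟨hcont, hopen, hinj⟩ => ⟨continuous_def.2 hcont, hopen,
      fun _ => isDiscrete_iff_isolated.2 fun x hx => hx ▸ hinj x⟩⟩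

lemma IsRankFn.comp_isDMap {L : Type w} [Preorder L] {τ : TopologicalSpace X}
    {σ : TopologicalSpace Y} {h : Y → L} (H : IsRankFn σ h) {f : X → Y} (hf : IsDMap τ σ f) :
    IsRankFn τ (h ∘ f) := by
  obtain ⟨hcont, hopen, hinj⟩ := isDMap_iff.1 hf
  refine ⟨fun x => ?_, fun x U hU hx β hβ => ?_⟩
  · obtain ⟨V, hV, hxV, hlt⟩ := H.lt (f x)
    obtain ⟨U, hU, hxU, hinjU⟩ := hinj x
    exact ⟨U ∩ f ⁻¹' V, hU.inter (hcont V hV), ⟨hxU, hxV⟩,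
      fun y hy hne => hlt _ hy.2 fun e => hne (hinjU y hy.1 e)⟩
  · obtain ⟨_, ⟨y, hy, rfl⟩, e⟩ := H.hit (f x) _ (hopen U hU) ⟨x, hx, rfl⟩ β hβ
    exact ⟨y, hy, e⟩

lemma IsRankFn.isLExtension {τ σ : TopologicalSpace X} {h : X → Ordinal.{u}} (H : IsRankFn τ h)
    (hle : σ ≤ τ) (hit : ∀ x U, IsOpen[σ] U → x ∈ U → ∀ β < h x, ∃ y ∈ U, h y = β)
    (hn : ∀ U, IsOpen[σ] U → ∀ x ∈ U, ¬ Order.IsSuccLimit (h x) →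
      ∃ V, IsOpen[τ] V ∧ x ∈ V ∧ V ⊆ U) : IsLExtension τ σ := by
  have H' : IsRankFn σ h := ⟨fun x =>
    let ⟨U, hU, hlt⟩ := H.lt x
    ⟨U, hle U hU, hlt⟩, hit⟩
  exact ⟨⟨hle, fun x => by rw [H.rank_eq, H'.rank_eq]⟩, H.rank_eq ▸ hn⟩

namespace IsLExtension

variable {τ σ υ : TopologicalSpace X}

lemma isRankFn {h : X → Ordinal.{u}} (hσ : IsLExtension τ σ) (H : IsRankFn τ h) :
    IsRankFn σ h := by
  have hrank : rank σ = h := (funext hσ.rank_eq).trans H.rank_eq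
  exact hrank ▸ (H.isScattered.mono hσ.extends_base).isRankFn

protected lemma refl (τ : TopologicalSpace X) : IsLExtension τ τ :=
  ⟨⟨le_rfl, fun _ => rfl⟩, fun U hU _ hx _ => ⟨U, hU, hx, subset_rfl⟩⟩

protected lemma trans (h : IsLExtension τ σ) (h' : IsLExtension σ υ) : IsLExtension τ υ := by
  refine ⟨⟨h'.extends_base.trans h.extends_base, fun x => (h'.rank_eq x).trans (h.rank_eq x)⟩,
    fun U hU x hx hl => ?_⟩
  obtain ⟨V, hV, hxV, hVU⟩ := h'.nhds_of_not_limit U hU x hx (by rwa [h.rank_eq])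
  obtain ⟨W, hW, hxW, hWV⟩ := h.nhds_of_not_limit V hV x hxV hl
  exact ⟨W, hW, hxW, hWV.trans hVU⟩

end IsLExtension

lemma exists_isOpen_subset_of_isOpen_sInf {c : Set (TopologicalSpace X)}
    (hc : IsChain (· ≤ ·) c) (hne : c.Nonempty) {U : Set X} (hU : IsOpen[sInf c] U) {x : X}
    (hx : x ∈ U) : ∃ σ ∈ c, ∃ V, IsOpen[σ] V ∧ x ∈ V ∧ V ⊆ U := by
  have hnhds : U ∈ @nhds X (sInf c) x := @IsOpen.mem_nhds X (sInf c) _ _ hU hx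
  have hdir : DirectedOn ((fun t => @nhds X t x) ⁻¹'o (· ≥ ·)) c := by
    intro a ha b hb
    rcases hc.total ha hb with hab | hab
    · exact ⟨a, ha, le_rfl, nhds_mono hab⟩
    · exact ⟨b, hb, nhds_mono hab, le_rfl⟩
  rw [nhds_sInf, Filter.mem_biInf_of_directed hdir hne] at hnhds
  obtain ⟨σ, hσ, h⟩ := hnhds
  obtain ⟨V, hVU, hV, hxV⟩ := mem_nhds_iff.1 h
  exact ⟨σ, hσ, V, hV, hxV, hVU⟩

lemma IsScattered.isLExtension_sInf {τ : TopologicalSpace X} (hs : IsScattered τ)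
    {c : Set (TopologicalSpace X)} (hc : IsChain (· ≤ ·) c) (hne : c.Nonempty)
    (hext : ∀ σ ∈ c, IsLExtension τ σ) : IsLExtension τ (sInf c) := by
  obtain ⟨σ₀, hσ₀⟩ := hne
  refine hs.isRankFn.isLExtension ((sInf_le hσ₀).trans (hext σ₀ hσ₀).extends_base) ?_ ?_
  · intro x U hU hx β hβ
    obtain ⟨σ, hσ, V, hV, hxV, hVU⟩ :=
      exists_isOpen_subset_of_isOpen_sInf hc ⟨σ₀, hσ₀⟩ hU hx
    obtain ⟨y, hy, e⟩ := ((hext σ hσ).isRankFn hs.isRankFn).hit x V hV hxV β hβ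
    exact ⟨y, hVU hy, e⟩
  · intro U hU x hx hl
    obtain ⟨σ, hσ, V, hV, hxV, hVU⟩ :=
      exists_isOpen_subset_of_isOpen_sInf hc ⟨σ₀, hσ₀⟩ hU hx
    obtain ⟨W, hW, hxW, hWV⟩ := (hext σ hσ).nhds_of_not_limit V hV x hxV hl
    exact ⟨W, hW, hxW, hWV.trans hVU⟩

theorem IsScattered.exists_isLMaximalLExtension {τ : TopologicalSpace X} (hs : IsScattered τ) :
    ∃ σ, IsLMaximalLExtension τ σ := by
  obtain ⟨m, hm⟩ := zorn_le₀ (α := (TopologicalSpace X)ᵒᵈ) {σ | IsLExtension τ σ.ofDual} (by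
    intro c hcs hc
    rcases c.eq_empty_or_nonempty with rfl | hne
    · exact ⟨OrderDual.toDual τ, IsLExtension.refl τ, by simp⟩
    · exact ⟨OrderDual.toDual (sInf (OrderDual.toDual ⁻¹' c)),
        hs.isLExtension_sInf (fun a ha b hb hab => (hc ha hb hab).symm) hne fun _ hσ => hcs hσ,
        fun z hz => sInf_le (α := TopologicalSpace X) hz⟩)
  refine ⟨m.ofDual, hm.prop, fun σ hσ => le_antisymm hσ.extends_base ?_⟩
  exact hm.2 (y := OrderDual.toDual σ) (IsLExtension.trans hm.prop hσ) hσ.extends_base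

lemma exists_isOpen_of_isOpen_inf_generateFrom {τ : TopologicalSpace X} {s U : Set X}
    (hU : IsOpen[τ ⊓ TopologicalSpace.generateFrom {s}] U) {x : X} (hx : x ∈ U) :
    ∃ N, IsOpen[τ] N ∧ x ∈ N ∧ (x ∉ s ∧ N ⊆ U ∨ x ∈ s ∧ N ∩ s ⊆ U) := by
  have hnhds := @IsOpen.mem_nhds X (τ ⊓ TopologicalSpace.generateFrom {s}) _ _ hU hx
  rw [nhds_inf, TopologicalSpace.nhds_generateFrom] at hnhds
  by_cases hxs : x ∈ s
  · have hbasis : {t | x ∈ t ∧ t ∈ ({s} : Set (Set X))} = {s} := by ext; aesop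
    rw [hbasis, iInf_singleton, Filter.mem_inf_principal] at hnhds
    obtain ⟨N, hNU, hN, hxN⟩ := mem_nhds_iff.1 hnhds
    exact ⟨N, hN, hxN, Or.inr ⟨hxs, fun y hy => hNU hy.1 hy.2⟩⟩
  · have hbasis : {t | x ∈ t ∧ t ∈ ({s} : Set (Set X))} = ∅ := by ext; aesop
    rw [hbasis, iInf_emptyset, inf_top_eq] at hnhds
    obtain ⟨N, hNU, hN, hxN⟩ := mem_nhds_iff.1 hnhds
    exact ⟨N, hN, hxN, Or.inl ⟨hxs, hNU⟩⟩

lemma IsRankFn.isLExtension_inf_generateFrom_insert {τ : TopologicalSpace X}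
    {h : X → Ordinal.{u}} (H : IsRankFn τ h) {x : X} (hx : Order.IsSuccLimit (h x)) {V : Set X}
    (hV : IsOpen[τ] V) (hun : ∀ N, IsOpen[τ] N → x ∈ N → ∀ β < h x, ∃ y ∈ N ∩ V, β ≤ h y) :
    IsLExtension τ (τ ⊓ TopologicalSpace.generateFrom {insert x V}) := by
  have hne : ∀ U, IsOpen[τ ⊓ TopologicalSpace.generateFrom {insert x V}] U → ∀ y ∈ U, y ≠ x →
      ∃ W, IsOpen[τ] W ∧ y ∈ W ∧ W ⊆ U := by
    intro U hU y hy hyx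
    obtain ⟨N, hN, hyN, ⟨-, hNU⟩ | ⟨hyV, hNU⟩⟩ := exists_isOpen_of_isOpen_inf_generateFrom hU hy
    · exact ⟨N, hN, hyN, hNU⟩
    · exact ⟨N ∩ V, hN.inter hV, ⟨hyN, hyV.resolve_left hyx⟩,
        (Set.inter_subset_inter_right N (Set.subset_insert x V)).trans hNU⟩
  refine H.isLExtension inf_le_left (fun y U hU hy β hβ => ?_)
    fun U hU y hy hl => hne U hU y hy fun e => hl (e ▸ hx)
  rcases eq_or_ne y x with rfl | hyx
  · obtain ⟨N, hN, hyN, ⟨hy', -⟩ | ⟨-, hNU⟩⟩ := exists_isOpen_of_isOpen_inf_generateFrom hU hy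
    · exact absurd (Set.mem_insert y V) hy'
    have hNVU : N ∩ V ⊆ U :=
      (Set.inter_subset_inter_right N (Set.subset_insert y V)).trans hNU
    obtain ⟨z, hz, hle⟩ := hun N hN hyN β hβ
    rcases hle.eq_or_lt with e | hlt
    · exact ⟨z, hNVU hz, e.symm⟩
    · obtain ⟨w, hw, e⟩ := H.hit z (N ∩ V) (hN.inter hV) hz β hlt
      exact ⟨w, hNVU hw, e⟩
  · obtain ⟨W, hW, hyW, hWU⟩ := hne U hU y hy hyx
    obtain ⟨w, hw, e⟩ := H.hit y W hW hyW β hβ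
    exact ⟨w, hWU hw, e⟩

lemma IsLMaximal.isOpen_insert {τ : TopologicalSpace X} {h : X → Ordinal.{u}} (hm : IsLMaximal τ)
    (H : IsRankFn τ h) {x : X} (hx : Order.IsSuccLimit (h x)) {V : Set X} (hV : IsOpen[τ] V)
    (hun : ∀ N, IsOpen[τ] N → x ∈ N → ∀ β < h x, ∃ y ∈ N ∩ V, β ≤ h y) :
    IsOpen[τ] (insert x V) :=
  hm _ (H.isLExtension_inf_generateFrom_insert hx hV hun) ▸
    (inf_le_right : τ ⊓ TopologicalSpace.generateFrom {insert x V} ≤ _) _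
      (TopologicalSpace.isOpen_generateFrom_of_mem rfl)

lemma nextTopology_le (τ : TopologicalSpace X) : nextTopology τ ≤ τ :=
  fun _ hU => TopologicalSpace.isOpen_generateFrom_of_mem (Or.inl hU)

lemma isOpen_nextTopology_derivedSet (τ : TopologicalSpace X) (A : Set X) :
    IsOpen[nextTopology τ] (@derivedSet X τ A) :=
  TopologicalSpace.isOpen_generateFrom_of_mem (Or.inr ⟨A, rfl⟩)

lemma IsRankFn.isOpen_nextTopology_gt {L : Type w} [Preorder L] {τ : TopologicalSpace X}
    {h : X → L} (H : IsRankFn τ h) (a : L) : IsOpen[nextTopology τ] {y | a < h y} := by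
  have hset : {y | a < h y} = @derivedSet X τ {y | a ≤ h y} :=
    Set.ext fun _ => H.mem_derivedSet_iff.symm
  exact hset ▸ isOpen_nextTopology_derivedSet τ _

lemma IsRankFn.isOpen_nextTopology_ge {τ : TopologicalSpace X} {h : X → Ordinal.{w}}
    (H : IsRankFn τ h) {η : Ordinal.{w}} (hη : ¬ Order.IsSuccLimit η) :
    IsOpen[nextTopology τ] {y | η ≤ h y} := by
  rcases Ordinal.zero_or_succ_or_isSuccLimit η with rfl | ⟨b, rfl⟩ | hl
  · simp
  · simpa only [Order.succ_le_iff] using H.isOpen_nextTopology_gt b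
  · exact absurd hl hη

lemma IsLMaximal.exists_isOpen_bounded_off_closure {τ : TopologicalSpace X}
    {h : X → Ordinal.{u}} (hm : IsLMaximal τ) (H : IsRankFn τ h) {A : Set X} {x : X}
    (hx : x ∈ @derivedSet X τ A) (hl : Order.IsSuccLimit (h x)) :
    ∃ N, IsOpen[τ] N ∧ x ∈ N ∧ ∃ β < h x, ∀ y ∈ N, y ∉ @closure X τ A → h y < β := by
  have hnot : ¬ IsOpen[τ] (insert x (@closure X τ A)ᶜ) := by
    intro ho
    obtain ⟨a, ha, haA, hne⟩ := mem_derivedSet_iff_open.1 hx _ ho (Set.mem_insert _ _)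
    exact ha.resolve_left hne (subset_closure haA)
  have hbdd := mt (hm.isOpen_insert H hl isClosed_closure.isOpen_compl) hnot
  push Not at hbdd
  obtain ⟨N, hN, hxN, β, hβ, hNβ⟩ := hbdd
  exact ⟨N, hN, hxN, β, hβ, fun y hy hyA => hNβ y ⟨hy, hyA⟩⟩

lemma IsLMaximal.exists_isOpen_subset_derivedSet {τ : TopologicalSpace X} {h : X → Ordinal.{u}}
    (hm : IsLMaximal τ) (H : IsRankFn τ h) {A : Set X} {x : X} (hx : x ∈ @derivedSet X τ A) :
    ∃ N, IsOpen[τ] N ∧ x ∈ N ∧ ∃ a < h x, ∀ y ∈ N, a < h y → y ∈ @derivedSet X τ A := by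
  obtain ⟨U, hU, hxU, hlt⟩ := H.lt x
  rcases Ordinal.zero_or_succ_or_isSuccLimit (h x) with h0 | ⟨b, hb⟩ | hl
  · obtain ⟨y, hy, -, hne⟩ := mem_derivedSet_iff_open.1 hx U hU hxU
    exact absurd (h0 ▸ hlt y hy hne) not_lt_zero
  · refine ⟨U, hU, hxU, b, hb ▸ Order.lt_succ b, fun y hy hby => ?_⟩
    rcases eq_or_ne y x with rfl | hne
    · exact hx
    · exact absurd hby (Order.lt_succ_iff.1 (hb ▸ hlt y hy hne)).not_gt
  · obtain ⟨N, hN, hxN, β, hβ, hNβ⟩ := hm.exists_isOpen_bounded_off_closure H hx hl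
    refine ⟨N, hN, hxN, β, hβ, fun y hy hβy => mem_derivedSet_iff_open.2 fun M hM hyM => ?_⟩
    obtain ⟨z, ⟨hzM, hzN⟩, hz⟩ := H.hit y (M ∩ N) (hM.inter hN) ⟨hyM, hy⟩ β hβy
    have hzA : z ∈ @closure X τ A := by_contra fun hzA => (hNβ z hzN hzA).ne hz
    obtain ⟨a, ⟨haM, hlt⟩, haA⟩ := mem_closure_iff.1 hzA (M ∩ {w | h w < h y})
      (hM.inter (H.isOpen_lt _)) ⟨hzM, hz.trans_lt hβy⟩
    exact ⟨a, haM, haA, ne_of_apply_ne h (Set.mem_ofPred_eq ▸ hlt).ne⟩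

lemma isOpen_inf_inter {σ τ : TopologicalSpace X} {U V : Set X} (hU : IsOpen[σ] U)
    (hV : IsOpen[τ] V) : IsOpen[σ ⊓ τ] (U ∩ V) :=
  have hU' : IsOpen[σ ⊓ τ] U := (inf_le_left : σ ⊓ τ ≤ σ) _ hU
  have hV' : IsOpen[σ ⊓ τ] V := (inf_le_right : σ ⊓ τ ≤ τ) _ hV
  (σ ⊓ τ).isOpen_inter U V hU' hV'

lemma isOpen_inf_induced_of_forall {τ : TopologicalSpace X} {θ : TopologicalSpace Y} {r : X → Y}
    {U : Set X} (h : ∀ x ∈ U, ∃ N V, IsOpen[τ] N ∧ IsOpen[θ] V ∧ x ∈ N ∧ r x ∈ V ∧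
      N ∩ r ⁻¹' V ⊆ U) : IsOpen[τ ⊓ TopologicalSpace.induced r θ] U := by
  refine isOpen_of_forall_exists_subset fun x hx => ?_
  obtain ⟨N, V, hN, hV, hxN, hxV, hNU⟩ := h x hx
  exact ⟨N ∩ r ⁻¹' V, isOpen_inf_inter hN ⟨V, hV, rfl⟩, ⟨hxN, hxV⟩, hNU⟩

lemma exists_isOpen_of_isOpen_inf_induced {τ : TopologicalSpace X} {θ : TopologicalSpace Y}
    {r : X → Y} {U : Set X} (hU : IsOpen[τ ⊓ TopologicalSpace.induced r θ] U) {x : X}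
    (hx : x ∈ U) :
    ∃ N V, IsOpen[τ] N ∧ IsOpen[θ] V ∧ x ∈ N ∧ r x ∈ V ∧ N ∩ r ⁻¹' V ⊆ U := by
  have hnhds := @IsOpen.mem_nhds X (τ ⊓ TopologicalSpace.induced r θ) _ _ hU hx
  rw [nhds_inf, nhds_induced, Filter.mem_inf_iff] at hnhds
  obtain ⟨A, hA, B, ⟨C, hC, hCB⟩, rfl⟩ := hnhds
  obtain ⟨N, hNA, hN, hxN⟩ := mem_nhds_iff.1 hA
  obtain ⟨V, hVC, hV, hxV⟩ := mem_nhds_iff.1 hC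
  exact ⟨N, V, hN, hV, hxN, hxV, fun y hy => ⟨hNA hy.1, hCB (hVC hy.2)⟩⟩

lemma IsLMaximal.nextTopology_eq {τ : TopologicalSpace X} {h : X → Ordinal.{u}}
    (hm : IsLMaximal τ) (H : IsRankFn τ h) :
    nextTopology τ = τ ⊓ TopologicalSpace.induced h (Preorder.topology Ordinal.{u}) := by
  let _ := Preorder.topology Ordinal.{u}
  have : OrderTopology Ordinal.{u} := ⟨rfl⟩
  refine le_antisymm (le_inf (nextTopology_le τ) ?_) (le_generateFrom ?_)
  · refine continuous_iff_le_induced.1 (continuous_generateFrom_iff.2 ?_)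
    rintro _ ⟨a, rfl | rfl⟩
    · exact H.isOpen_nextTopology_gt a
    · exact nextTopology_le τ _ (H.isOpen_lt a)
  · rintro W (hW | ⟨A, rfl⟩)
    · exact (inf_le_left : τ ⊓ TopologicalSpace.induced h _ ≤ τ) W hW
    · refine isOpen_inf_induced_of_forall fun x hx => ?_
      obtain ⟨N, hN, hxN, a, ha, hNA⟩ := hm.exists_isOpen_subset_derivedSet H hx
      exact ⟨N, Set.Ioi a, hN, isOpen_Ioi, hxN, ha, fun y hy => hNA y hy.1 hy.2⟩

lemma IsDMap.inf_induced {τ : TopologicalSpace X} {σ θ : TopologicalSpace Y} {r : X → Y}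
    (hr : IsDMap τ σ r) : IsDMap (τ ⊓ TopologicalSpace.induced r θ) (σ ⊓ θ) r := by
  obtain ⟨-, hopen, hinj⟩ := isDMap_iff.1 hr
  refine isDMap_iff.2 ⟨fun V hV => ?_, fun U hU => isOpen_of_forall_exists_subset ?_, fun x => ?_⟩
  · have hle : τ ⊓ TopologicalSpace.induced r θ ≤ TopologicalSpace.induced r (σ ⊓ θ) := by
      rw [induced_inf]
      exact inf_le_inf_right _ (continuous_iff_le_induced.1 hr.continuous)
    exact hle _ ⟨V, hV, rfl⟩
  · rintro _ ⟨x, hx, rfl⟩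
    obtain ⟨N, V, hN, hV, hxN, hxV, hNU⟩ := exists_isOpen_of_isOpen_inf_induced hU hx
    refine ⟨r '' N ∩ V, isOpen_inf_inter (hopen N hN) hV, ⟨⟨x, hxN, rfl⟩, hxV⟩, ?_⟩
    rintro _ ⟨⟨y, hy, rfl⟩, hyV⟩
    exact ⟨y, hNU ⟨hy, hyV⟩, rfl⟩
  · obtain ⟨U, hU, hxU, hinjU⟩ := hinj x
    exact ⟨U, (inf_le_left : τ ⊓ TopologicalSpace.induced r θ ≤ τ) _ hU, hxU, hinjU⟩

lemma IsDMap.inf_induced_of_le {τ : TopologicalSpace X} {θ θ' : TopologicalSpace Y} {r : X → Y}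
    (hr : IsDMap τ θ r) (hle : θ' ≤ θ) : IsDMap (τ ⊓ TopologicalSpace.induced r θ') θ' r := by
  have h := hr.inf_induced (θ := θ')
  rwa [inf_eq_right.2 hle] at h

section OpenSubspaces

variable {Z O : Type u}

/-- `i` identifies `O` with a `τ`-open set. The topology of the open subspace is
`TopologicalSpace.induced i τ`; keeping `O` bare allows `τ` to vary. -/
structure IsOpenInj (τ : TopologicalSpace Z) (i : O → Z) : Prop where
  inj : Function.Injective i
  isOpen_range : IsOpen[τ] (Set.range i)

namespace IsOpenInj

variable {τ : TopologicalSpace Z} {i : O → Z}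

lemma mono {τ' : TopologicalSpace Z} (hi : IsOpenInj τ i) (h : τ' ≤ τ) : IsOpenInj τ' i :=
  ⟨hi.inj, h _ hi.isOpen_range⟩

lemma isOpen_induced (hi : IsOpenInj τ i) {U : Set O} :
    IsOpen[TopologicalSpace.induced i τ] U ↔ IsOpen[τ] (i '' U) := by
  rw [isOpen_induced_iff]
  constructor
  · rintro ⟨V, hV, rfl⟩
    rw [Set.image_preimage_eq_inter_range]
    exact hV.inter hi.isOpen_range
  · exact fun h => ⟨_, h, Set.preimage_image_eq U hi.inj⟩

lemma isDMap (hi : IsOpenInj τ i) : IsDMap (TopologicalSpace.induced i τ) τ i :=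
  isDMap_iff.2 ⟨fun V hV => ⟨V, hV, rfl⟩, fun _ hU => hi.isOpen_induced.1 hU,
    fun _ => ⟨Set.univ, @isOpen_univ O (TopologicalSpace.induced i τ), trivial,
      fun _ _ e => hi.inj e⟩⟩

lemma isRankFn {L : Type w} [Preorder L] (hi : IsOpenInj τ i) {h : Z → L} (H : IsRankFn τ h) :
    IsRankFn (TopologicalSpace.induced i τ) (h ∘ i) :=
  H.comp_isDMap hi.isDMap

lemma isLExtension_induced (hi : IsOpenInj τ i) {τ' : TopologicalSpace Z} (hs : IsScattered τ)
    (hτ : IsLExtension τ τ') :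
    IsLExtension (TopologicalSpace.induced i τ) (TopologicalSpace.induced i τ') := by
  have H := hs.isRankFn
  have hi' := hi.mono hτ.extends_base
  refine (hi.isRankFn H).isLExtension (induced_mono hτ.extends_base)
    (hi'.isRankFn (hτ.isRankFn H)).hit fun U hU x hx hl => ?_
  obtain ⟨V, hV, hxV, hVU⟩ :=
    hτ.nhds_of_not_limit _ (hi'.isOpen_induced.1 hU) (i x) ⟨x, hx, rfl⟩ hl
  refine ⟨i ⁻¹' V, ⟨V, hV, rfl⟩, hxV, fun y hy => ?_⟩
  obtain ⟨z, hz, e⟩ := hVU hy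
  exact hi.inj e ▸ hz

end IsOpenInj

/-- The topology that agrees with `t` on the image of `i : O → Z` and with `τ` near all other
points. -/
@[reducible]
def extendTopology (τ : TopologicalSpace Z) (i : O → Z) (t : TopologicalSpace O) :
    TopologicalSpace Z where
  IsOpen U := IsOpen[t] (i ⁻¹' U) ∧ ∀ z ∈ U, z ∉ Set.range i → U ∈ @nhds Z τ z
  isOpen_univ := ⟨isOpen_univ, fun _ _ _ => Filter.univ_mem⟩
  isOpen_inter := fun _ _ hU hV => ⟨hU.1.inter hV.1, fun z hz hzi =>
    Filter.inter_mem (hU.2 z hz.1 hzi) (hV.2 z hz.2 hzi)⟩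
  isOpen_sUnion := fun S hS => by
    refine ⟨?_, fun z ⟨U, hU, hz⟩ hzi =>
      Filter.mem_of_superset ((hS U hU).2 z hz hzi) (Set.subset_sUnion_of_mem hU)⟩
    rw [Set.preimage_sUnion]
    exact isOpen_biUnion fun U hU => (hS U hU).1

namespace IsOpenInj

variable {τ : TopologicalSpace Z} {i : O → Z} {t : TopologicalSpace O}

lemma extendTopology_le (ht : t ≤ TopologicalSpace.induced i τ) : extendTopology τ i t ≤ τ :=
  fun U hU => ⟨ht _ ⟨U, hU, rfl⟩, fun _ hz _ => hU.mem_nhds hz⟩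

lemma isLExtension_extendTopology (hi : IsOpenInj τ i) (hs : IsScattered τ)
    (ht : IsLExtension (TopologicalSpace.induced i τ) t) :
    IsLExtension τ (extendTopology τ i t) := by
  have H := hs.isRankFn
  refine H.isLExtension (extendTopology_le ht.extends_base) (fun x U hU hx β hβ => ?_)
    fun U hU x hx hl => ?_
  all_goals by_cases hxi : x ∈ Set.range i
  · obtain ⟨o, rfl⟩ := hxi
    obtain ⟨y, hy, e⟩ := (ht.isRankFn (hi.isRankFn H)).hit o _ hU.1 hx β hβ
    exact ⟨i y, hy, e⟩
  · obtain ⟨W, hWU, hW, hxW⟩ := mem_nhds_iff.1 (hU.2 x hx hxi)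
    obtain ⟨y, hy, e⟩ := H.hit x W hW hxW β hβ
    exact ⟨y, hWU hy, e⟩
  · obtain ⟨o, rfl⟩ := hxi
    obtain ⟨V, hV, hoV, hVU⟩ := ht.nhds_of_not_limit _ hU.1 o hx (by rwa [(hi.isRankFn H).rank_eq])
    exact ⟨i '' V, hi.isOpen_induced.1 hV, ⟨o, hoV, rfl⟩, Set.image_subset_iff.2 hVU⟩
  · obtain ⟨W, hWU, hW, hxW⟩ := mem_nhds_iff.1 (hU.2 x hx hxi)
    exact ⟨W, hW, hxW, hWU⟩

lemma induced_extendTopology (hi : IsOpenInj τ i) (ht : t ≤ TopologicalSpace.induced i τ) :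
    TopologicalSpace.induced i (extendTopology τ i t) = t := by
  refine TopologicalSpace.ext_iff.2 fun U => ?_
  rw [(hi.mono (extendTopology_le ht)).isOpen_induced]
  refine ⟨fun hU => Set.preimage_image_eq U hi.inj ▸ hU.1, fun hU => ⟨?_, fun z hz hzi =>
    absurd (Set.image_subset_range _ _ hz) hzi⟩⟩
  rwa [Set.preimage_image_eq U hi.inj]

lemma induced_extendTopology_of_disjoint {O' : Type u} {j : O' → Z} (hj : IsOpenInj τ j)
    (hd : Disjoint (Set.range i) (Set.range j)) (ht : t ≤ TopologicalSpace.induced i τ) :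
    TopologicalSpace.induced j (extendTopology τ i t) = TopologicalSpace.induced j τ := by
  refine TopologicalSpace.ext_iff.2 fun U => ?_
  rw [(hj.mono (extendTopology_le ht)).isOpen_induced, hj.isOpen_induced]
  refine ⟨fun hU => isOpen_iff_mem_nhds.2 fun z hz => hU.2 z hz fun hzi => ?_,
    fun hU => extendTopology_le ht _ hU⟩
  exact Set.disjoint_left.1 hd hzi (Set.image_subset_range _ _ hz)

end IsOpenInj

end OpenSubspaces

section Lifting

variable {X Y Z O O₁ O₂ Y₁ Y₂ : Type u}

lemma IsDMap.isLExtension_inf_induced {τ : TopologicalSpace X} {θ θ' : TopologicalSpace Y}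
    {r : X → Y} (hr : IsDMap τ θ r) (hs : IsScattered θ) (hθ : IsLExtension θ θ') :
    IsLExtension τ (τ ⊓ TopologicalSpace.induced r θ') := by
  have H := hs.isRankFn
  refine (H.comp_isDMap hr).isLExtension inf_le_left
    ((hθ.isRankFn H).comp_isDMap (hr.inf_induced_of_le hθ.extends_base)).hit
    fun U hU x hx hl => ?_
  obtain ⟨N, V, hN, hV, hxN, hxV, hNU⟩ := exists_isOpen_of_isOpen_inf_induced hU hx
  obtain ⟨W, hW, hxW, hWV⟩ := hθ.nhds_of_not_limit V hV (r x) hxV hl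
  exact ⟨N ∩ r ⁻¹' W, hN.inter ((isDMap_iff.1 hr).1 W hW), ⟨hxN, hxW⟩,
    fun y hy => hNU ⟨hy.1, hWV hy.2⟩⟩

-- Induction on the rank of `r x`: in the limit case the image of the points of `U` of smaller rank
-- is open by induction, and `ℓ`-maximality of `θ` allows adding `r x` to it.
lemma IsDMap.exists_isOpen_subset_image {τ τ' : TopologicalSpace X} {θ : TopologicalSpace Y}
    {r : X → Y} (hr : IsDMap τ θ r) (hs : IsScattered θ) (hm : IsLMaximal θ)
    (hτ : IsLExtension τ τ') {U : Set X} (hU : IsOpen[τ'] U) {x : X} (hx : x ∈ U) :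
    ∃ V, IsOpen[θ] V ∧ r x ∈ V ∧ V ⊆ r '' U := by
  have H := hs.isRankFn
  have Hτ := H.comp_isDMap hr
  have Hτ' := hτ.isRankFn Hτ
  obtain ⟨hcont, hopen, -⟩ := isDMap_iff.1 hr
  induction hα : rank θ (r x) using WellFoundedLT.induction generalizing x U with
  | _ α ih =>
    subst hα
    by_cases hl : Order.IsSuccLimit (rank θ (r x))
    · set U₀ := U ∩ {y | (rank θ ∘ r) y < rank θ (r x)}
      have hU₀ : IsOpen[τ'] U₀ := hU.inter (Hτ'.isOpen_lt _)
      have hV₀ : IsOpen[θ] (r '' U₀) := by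
        refine isOpen_of_forall_exists_subset ?_
        rintro _ ⟨y, hy, rfl⟩
        exact ih _ hy.2 hU₀ hy rfl
      refine ⟨_, hm.isOpen_insert H hl hV₀ (fun N hN hxN β hβ => ?_), Set.mem_insert _ _,
        Set.insert_subset ⟨x, hx, rfl⟩ (Set.image_mono Set.inter_subset_left)⟩
      obtain ⟨z, ⟨hzU, hzN⟩, rfl⟩ := Hτ'.hit x (U ∩ r ⁻¹' N)
        (hU.inter (hτ.extends_base _ (hcont N hN))) ⟨hx, hxN⟩ β hβ
      exact ⟨r z, ⟨hzN, z, ⟨hzU, hβ⟩, rfl⟩, le_rfl⟩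
    · obtain ⟨V, hV, hxV, hVU⟩ := hτ.nhds_of_not_limit U hU x hx (by rwa [Hτ.rank_eq])
      exact ⟨r '' V, hopen V hV, ⟨x, hxV, rfl⟩, Set.image_mono hVU⟩

lemma IsDMap.of_isLExtension {τ τ' : TopologicalSpace X} {θ : TopologicalSpace Y} {r : X → Y}
    (hr : IsDMap τ θ r) (hs : IsScattered θ) (hm : IsLMaximal θ) (hτ : IsLExtension τ τ') :
    IsDMap τ' θ r := by
  obtain ⟨hcont, -, hinj⟩ := isDMap_iff.1 hr
  refine isDMap_iff.2 ⟨fun V hV => hτ.extends_base _ (hcont V hV),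
    fun U hU => isOpen_of_forall_exists_subset ?_, fun x => ?_⟩
  · rintro _ ⟨x, hx, rfl⟩
    exact hr.exists_isOpen_subset_image hs hm hτ hU hx
  · obtain ⟨U, hU, hxU, hinjU⟩ := hinj x
    exact ⟨U, hτ.extends_base _ hU, hxU, hinjU⟩

lemma IsDMap.of_isLExtension_induced {τ τ' : TopologicalSpace Z} {θ : TopologicalSpace Y}
    {i : O → Z} {r : O → Y} (hr : IsDMap (TopologicalSpace.induced i τ) θ r)
    (hi : IsOpenInj τ i) (hs : IsScattered τ) (hs' : IsScattered θ) (hm : IsLMaximal θ)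
    (hτ : IsLExtension τ τ') : IsDMap (TopologicalSpace.induced i τ') θ r :=
  hr.of_isLExtension hs' hm (hi.isLExtension_induced hs hτ)

lemma IsDMap.exists_isLExtension {τ : TopologicalSpace Z} {θ θ' : TopologicalSpace Y}
    {i : O → Z} {r : O → Y} (hr : IsDMap (TopologicalSpace.induced i τ) θ r)
    (hi : IsOpenInj τ i) (hs : IsScattered τ) (hs' : IsScattered θ) (hθ : IsLExtension θ θ') :
    ∃ τ', IsLExtension τ τ' ∧ IsDMap (TopologicalSpace.induced i τ') θ' r ∧
      ∀ {O' : Type u} {j : O' → Z}, IsOpenInj τ j → Disjoint (Set.range i) (Set.range j) →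
        TopologicalSpace.induced j τ' = TopologicalSpace.induced j τ := by
  have hext := hr.isLExtension_inf_induced hs' hθ
  refine ⟨extendTopology τ i (TopologicalSpace.induced i τ ⊓ TopologicalSpace.induced r θ'),
    hi.isLExtension_extendTopology hs hext, ?_,
    fun hj hd => hj.induced_extendTopology_of_disjoint hd hext.extends_base⟩
  rw [hi.induced_extendTopology hext.extends_base]
  exact hr.inf_induced_of_le hθ.extends_base

theorem IsDMap.exists_isLMaximalLExtension {τ : TopologicalSpace Z} {θ θ' : TopologicalSpace Y}
    {i : O → Z} {r : O → Y} (hr : IsDMap (TopologicalSpace.induced i τ) θ r)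
    (hi : IsOpenInj τ i) (hs : IsScattered τ) (hs' : IsScattered θ)
    (hθ : IsLMaximalLExtension θ θ') :
    ∃ τ', IsLMaximalLExtension τ τ' ∧ IsDMap (TopologicalSpace.induced i τ') θ' r := by
  obtain ⟨τ₁, hτ₁, hr₁, -⟩ := hr.exists_isLExtension hi hs hs' hθ.1
  have hs₁ := hs.mono hτ₁.extends_base
  obtain ⟨τ', hτ', hmax⟩ := hs₁.exists_isLMaximalLExtension
  exact ⟨τ', ⟨hτ₁.trans hτ', hmax⟩, hr₁.of_isLExtension_induced (hi.mono hτ₁.extends_base) hs₁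
    (hs'.mono hθ.1.extends_base) hθ.2 hτ'⟩

theorem exists_isLMaximalLExtension_lift {τ : TopologicalSpace Z} (hs : IsScattered τ)
    {i₁ : O₁ → Z} {i₂ : O₂ → Z} (hi₁ : IsOpenInj τ i₁) (hi₂ : IsOpenInj τ i₂)
    (hd : Disjoint (Set.range i₁) (Set.range i₂)) {r₁ : O₁ → Y₁} {r₂ : O₂ → Y₂}
    {θ₁ θ₁' : TopologicalSpace Y₁} {θ₂ θ₂' : TopologicalSpace Y₂}
    (hs₁ : IsScattered θ₁) (hs₂ : IsScattered θ₂)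
    (hr₁ : IsDMap (TopologicalSpace.induced i₁ τ) θ₁ r₁)
    (hr₂ : IsDMap (TopologicalSpace.induced i₂ τ) θ₂ r₂)
    (h₁ : IsLMaximalLExtension θ₁ θ₁') (h₂ : IsLMaximalLExtension θ₂ θ₂') :
    ∃ τ', IsLMaximalLExtension τ τ' ∧ IsDMap (TopologicalSpace.induced i₁ τ') θ₁' r₁ ∧
      IsDMap (TopologicalSpace.induced i₂ τ') θ₂' r₂ := by
  obtain ⟨σ, hσ, hrσ, hdisj⟩ := hr₁.exists_isLExtension hi₁ hs hs₁ h₁.1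
  have hr₂σ : IsDMap (TopologicalSpace.induced i₂ σ) θ₂ r₂ := (hdisj hi₂ hd).symm ▸ hr₂
  have hsσ := hs.mono hσ.extends_base
  obtain ⟨τ', hτ', hr'⟩ :=
    hr₂σ.exists_isLMaximalLExtension (hi₂.mono hσ.extends_base) hsσ hs₂ h₂
  exact ⟨τ', ⟨hσ.trans hτ'.1, hτ'.2⟩, hrσ.of_isLExtension_induced (hi₁.mono hσ.extends_base) hsσ
    (hs₁.mono h₁.1.extends_base) h₁.2 hτ'.1, hr'⟩

lemma IsDMap.nextTopology {τ : TopologicalSpace Z} {θ : TopologicalSpace Y} {i : O → Z}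
    {r : O → Y} (hr : IsDMap (TopologicalSpace.induced i τ) θ r) (hi : IsOpenInj τ i)
    (hs : IsScattered τ) (hs' : IsScattered θ) (hm : IsLMaximal τ) (hm' : IsLMaximal θ) :
    IsDMap (TopologicalSpace.induced i (nextTopology τ)) (nextTopology θ) r := by
  have H := hs.isRankFn
  have H' := hs'.isRankFn
  have hrank : rank τ ∘ i = rank θ ∘ r :=
    (hi.isRankFn H).rank_eq.symm.trans (H'.comp_isDMap hr).rank_eq
  rw [hm.nextTopology_eq H, hm'.nextTopology_eq H', induced_inf, induced_compose, hrank,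
    ← induced_compose]
  exact hr.inf_induced

end Lifting

/-- `τ 0, τ 1, …` is an infinite lme-space based on the scattered topology `base`. Its initial
segments are the lme-spaces of the theorem; not fixing the length lets sequences be shifted. -/
structure IsLMESeq (base : TopologicalSpace X) (τ : ℕ → TopologicalSpace X) : Prop where
  scattered_base : IsScattered base
  zero : IsLMaximalLExtension base (τ 0)
  succ : ∀ k, IsLMaximalLExtension (nextTopology (τ k)) (τ (k + 1))

namespace IsLMESeq

variable {base : TopologicalSpace X} {τ : ℕ → TopologicalSpace X}

lemma succ_le (h : IsLMESeq base τ) (k : ℕ) : τ (k + 1) ≤ nextTopology (τ k) :=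
  (h.succ k).1.extends_base

lemma le_base (h : IsLMESeq base τ) (k : ℕ) : τ k ≤ base := by
  induction k with
  | zero => exact h.zero.1.extends_base
  | succ k ih => exact (h.succ_le k).trans ((nextTopology_le _).trans ih)

lemma isScattered (h : IsLMESeq base τ) (k : ℕ) : IsScattered (τ k) :=
  h.scattered_base.mono (h.le_base k)

lemma isLMaximal (h : IsLMESeq base τ) (k : ℕ) : IsLMaximal (τ k) := by
  cases k with
  | zero => exact h.zero.2
  | succ k => exact (h.succ k).2

lemma tail (h : IsLMESeq base τ) : IsLMESeq (nextTopology (τ 0)) (fun k => τ (k + 1)) :=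
  ⟨(h.isScattered 0).mono (nextTopology_le _), h.succ 0, fun k => h.succ (k + 1)⟩

lemma cons {σ : TopologicalSpace X} (hs : IsScattered base) (hσ : IsLMaximalLExtension base σ)
    (h : IsLMESeq (nextTopology σ) τ) : IsLMESeq base (fun k => Nat.casesOn k σ τ) :=
  ⟨hs, hσ, fun k => by
    cases k with
    | zero => exact h.zero
    | succ k => exact h.succ k⟩

end IsLMESeq

section Lifting

variable {Z O₁ O₂ Y₁ Y₂ : Type u} {i₁ : O₁ → Z} {i₂ : O₂ → Z} {r₁ : O₁ → Y₁} {r₂ : O₂ → Y₂}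

lemma exists_isLMaximalLExtension_nextTopology {τ : TopologicalSpace Z} (hs : IsScattered τ)
    (hm : IsLMaximal τ) (hi₁ : IsOpenInj τ i₁) (hi₂ : IsOpenInj τ i₂)
    (hd : Disjoint (Set.range i₁) (Set.range i₂))
    {θ₁ θ₁' : TopologicalSpace Y₁} {θ₂ θ₂' : TopologicalSpace Y₂}
    (hs₁ : IsScattered θ₁) (hs₂ : IsScattered θ₂) (hm₁ : IsLMaximal θ₁) (hm₂ : IsLMaximal θ₂)
    (hr₁ : IsDMap (TopologicalSpace.induced i₁ τ) θ₁ r₁)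
    (hr₂ : IsDMap (TopologicalSpace.induced i₂ τ) θ₂ r₂)
    (h₁ : IsLMaximalLExtension (nextTopology θ₁) θ₁')
    (h₂ : IsLMaximalLExtension (nextTopology θ₂) θ₂') :
    ∃ τ', IsLMaximalLExtension (nextTopology τ) τ' ∧
      IsDMap (TopologicalSpace.induced i₁ τ') θ₁' r₁ ∧
      IsDMap (TopologicalSpace.induced i₂ τ') θ₂' r₂ :=
  exists_isLMaximalLExtension_lift (hs.mono (nextTopology_le τ)) (hi₁.mono (nextTopology_le τ))
    (hi₂.mono (nextTopology_le τ)) hd (hs₁.mono (nextTopology_le θ₁))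
    (hs₂.mono (nextTopology_le θ₂)) (hr₁.nextTopology hi₁ hs hs₁ hm hm₁)
    (hr₂.nextTopology hi₂ hs hs₂ hm hm₂) h₁ h₂

theorem exists_isLMESeq_lift {τ : TopologicalSpace Z} (hs : IsScattered τ)
    (hi₁ : IsOpenInj τ i₁) (hi₂ : IsOpenInj τ i₂) (hd : Disjoint (Set.range i₁) (Set.range i₂))
    {θ₁ : TopologicalSpace Y₁} {θ₂ : TopologicalSpace Y₂}
    (hr₁ : IsDMap (TopologicalSpace.induced i₁ τ) θ₁ r₁)
    (hr₂ : IsDMap (TopologicalSpace.induced i₂ τ) θ₂ r₂)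
    {υ₁ : ℕ → TopologicalSpace Y₁} {υ₂ : ℕ → TopologicalSpace Y₂}
    (h₁ : IsLMESeq θ₁ υ₁) (h₂ : IsLMESeq θ₂ υ₂) :
    ∃ σ : ℕ → TopologicalSpace Z, IsLMESeq τ σ ∧
      (∀ k, IsDMap (TopologicalSpace.induced i₁ (σ k)) (υ₁ k) r₁) ∧
      ∀ k, IsDMap (TopologicalSpace.induced i₂ (σ k)) (υ₂ k) r₂ := by
  let P (k : ℕ) (σ : TopologicalSpace Z) : Prop := σ ≤ τ ∧ IsLMaximal σ ∧
    IsDMap (TopologicalSpace.induced i₁ σ) (υ₁ k) r₁ ∧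
    IsDMap (TopologicalSpace.induced i₂ σ) (υ₂ k) r₂
  obtain ⟨σ₀, hσ₀, hσ₁, hσ₂⟩ := exists_isLMaximalLExtension_lift hs hi₁ hi₂ hd h₁.scattered_base
    h₂.scattered_base hr₁ hr₂ h₁.zero h₂.zero
  have hstep : ∀ k σ, P k σ → ∃ σ', P (k + 1) σ' ∧ IsLMaximalLExtension (nextTopology σ) σ' := by
    rintro k σ ⟨hle, hm, hd₁, hd₂⟩
    obtain ⟨σ', hσ', hd₁', hd₂'⟩ := exists_isLMaximalLExtension_nextTopology (hs.mono hle) hm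
      (hi₁.mono hle) (hi₂.mono hle) hd (h₁.isScattered k) (h₂.isScattered k) (h₁.isLMaximal k)
      (h₂.isLMaximal k) hd₁ hd₂ (h₁.succ k) (h₂.succ k)
    exact ⟨σ', ⟨hσ'.1.extends_base.trans ((nextTopology_le σ).trans hle), hσ'.2, hd₁', hd₂'⟩, hσ'⟩
  choose! F hF hF' using hstep
  let σ (k : ℕ) : TopologicalSpace Z := Nat.rec σ₀ F k
  have hσ : ∀ k, P k (σ k) := fun k => by
    induction k with
    | zero => exact ⟨hσ₀.1.extends_base, hσ₀.2, hσ₁, hσ₂⟩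
    | succ k ih => exact hF k _ ih
  exact ⟨σ, ⟨hs, hσ₀, fun k => hF' k _ (hσ k)⟩, fun k => (hσ k).2.2.1, fun k => (hσ k).2.2.2⟩

end Lifting

section RankMap

variable {L : Type v} [LinearOrder L]

lemma orderTopology_le_lowerSet [WellFoundedLT L] :
    Preorder.topology L ≤ Topology.lowerSet L := by
  let _ := Preorder.topology L
  have : OrderTopology L := ⟨rfl⟩
  intro s hs
  rcases IsLowerSet.eq_univ_or_Iio hs with rfl | ⟨a, rfl⟩
  · exact isOpen_univ
  · exact isOpen_Iio

lemma IsRankFn.isDMap_lowerSet {τ : TopologicalSpace X} {r : X → L} (H : IsRankFn τ r) :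
    IsDMap τ (Topology.lowerSet L) r := by
  refine isDMap_iff.2 ⟨fun V hV => H.isOpen_preimage hV, fun U hU => ?_, fun x => ?_⟩
  · rintro _ b hb ⟨x, hx, rfl⟩
    rcases hb.eq_or_lt with rfl | hb
    · exact ⟨x, hx, rfl⟩
    · exact H.hit x U hU hx b hb
  · obtain ⟨U, hU, hxU, hlt⟩ := H.lt x
    exact ⟨U, hU, hxU, fun y hy e => by_contra fun hne => (hlt y hy hne).ne e⟩

lemma IsRankFn.isDMap_inf_induced [WellFoundedLT L] {τ : TopologicalSpace X} {r : X → L}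
    (H : IsRankFn τ r) :
    IsDMap (τ ⊓ TopologicalSpace.induced r (Preorder.topology L)) (Preorder.topology L) r :=
  H.isDMap_lowerSet.inf_induced_of_le orderTopology_le_lowerSet

end RankMap

lemma IsRankFn.of_strictMono_comp {L : Type w} [LinearOrder L] {M : Type w'} [Preorder M]
    {τ : TopologicalSpace Y} {h : Y → M} (H : IsRankFn τ h) {i : X → Y}
    (hi : Function.Injective i) {r : X → L} {g : L → M} (hg : StrictMono g)
    (hgr : ∀ x, h (i x) = g (r x)) (hrange : h ⁻¹' Set.range g ⊆ Set.range i) :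
    IsRankFn (TopologicalSpace.induced i τ) r := by
  refine ⟨fun x => ?_, ?_⟩
  · obtain ⟨U, hU, hxU, hlt⟩ := H.lt (i x)
    refine ⟨i ⁻¹' U, ⟨U, hU, rfl⟩, hxU, fun y hy hne => hg.lt_iff_lt.1 ?_⟩
    rw [← hgr, ← hgr]
    exact hlt (i y) hy (hi.ne hne)
  · rintro x _ ⟨U, hU, rfl⟩ hx β hβ
    obtain ⟨y, hy, e⟩ := H.hit (i x) U hU hx (g β) (hgr x ▸ hg hβ)
    obtain ⟨z, rfl⟩ := hrange ⟨β, e.symm⟩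
    exact ⟨z, hy, hg.injective ((hgr z).symm.trans e)⟩

theorem IsLMaximal.isDMap_induced_nextTopology {Z O : Type u} {L : Type v} [LinearOrder L]
    [WellFoundedLT L] {τ : TopologicalSpace Z} {h : Z → Ordinal.{u}} (hm : IsLMaximal τ)
    (H : IsRankFn τ h) {i : O → Z} (hi : Function.Injective i) {r : O → L} {g : L → Ordinal.{u}}
    (hg : StrictMono g) (hconn : (Set.range g).OrdConnected) (hgr : ∀ x, h (i x) = g (r x))
    (hrange : h ⁻¹' Set.range g ⊆ Set.range i) :
    IsDMap (TopologicalSpace.induced i (nextTopology τ)) (Preorder.topology L) r := by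
  let _ := Preorder.topology Ordinal.{u}
  have : OrderTopology Ordinal.{u} := ⟨rfl⟩
  have hcomp : h ∘ i = g ∘ r := funext hgr
  rw [hm.nextTopology_eq H, induced_inf, induced_compose, hcomp, ← induced_compose,
    hg.induced_topology_eq_preorder hconn]
  exact (H.of_strictMono_comp hi hg hgr hrange).isDMap_inf_induced

section Arithmetic

open Ordinal Order

lemma isPrincipal_add_epsilon (o : Ordinal.{u}) : IsPrincipal (· + ·) (epsilon o) := by
  simpa only [omega0_opow_epsilon] using isPrincipal_add_omega0_opow (epsilon o)

lemma isPrincipal_mul_epsilon (o : Ordinal.{u}) : IsPrincipal (· * ·) (epsilon o) := by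
  simpa only [omega0_opow_epsilon] using isPrincipal_mul_omega0_opow_opow (epsilon o)

lemma omega0_opow_lt_epsilon {a o : Ordinal.{u}} (h : a < epsilon o) : ω ^ a < epsilon o := by
  rw [← omega0_opow_epsilon o]
  exact (opow_lt_opow_iff_right one_lt_omega0).2 h

lemma exists_eq_omega0_opow_mul_succ {γ : Ordinal.{u}} (hγ : γ ≠ 0) :
    ∃ ε ξ : Ordinal.{u}, γ = ω ^ ε * succ ξ := by
  induction γ using CNF.rec ω with
  | H0 => exact absurd rfl hγ
  | H o ho ih =>
    have hdec := div_add_mod o (ω ^ log ω o)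
    by_cases hr : o % ω ^ log ω o = 0
    · rw [hr, add_zero] at hdec
      obtain ⟨n, hn⟩ := lt_omega0.1 (div_opow_log_lt o one_lt_omega0)
      cases n with
      | zero => exact absurd (by rw [← hdec, hn, Nat.cast_zero, mul_zero]) ho
      | succ n => exact ⟨log ω o, n, by rw [succ_eq_add_one, ← Nat.cast_succ, ← hn, hdec]⟩
    · obtain ⟨ε, ξ, hε⟩ := ih hr
      have hlt : ω ^ ε < ω ^ log ω o :=
        (le_mul_left _ (bot_lt_succ ξ)).trans_lt (hε ▸ mod_lt _ (opow_pos _ omega0_pos).ne')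
      have hle : ε ≤ log ω o := ((opow_lt_opow_iff_right one_lt_omega0).1 hlt).le
      refine ⟨ε, ω ^ (log ω o - ε) * (o / ω ^ log ω o) + ξ, ?_⟩
      rw [succ_eq_add_one, add_assoc, ← succ_eq_add_one, mul_add, ← mul_assoc, ← opow_add,
        Ordinal.add_sub_cancel_of_le hle, ← hε, hdec]

lemma omega0_opow_dvd_omega0_opow_mul_succ {ε δ ξ : Ordinal.{u}} :
    ω ^ δ ∣ ω ^ ε * succ ξ ↔ δ ≤ ε := by
  refine ⟨fun h => ?_, fun h => (opow_dvd_opow _ h).trans (dvd_mul_right _ _)⟩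
  by_contra! hlt
  obtain ⟨c, hc⟩ := (opow_dvd_opow ω (succ_le_of_lt hlt)).trans h
  rw [opow_succ, mul_assoc] at hc
  have hsucc : succ ξ = ω * c := mul_left_cancel₀ (opow_pos ε omega0_pos).ne' hc
  exact not_isSuccPrelimit_succ ξ (isSuccPrelimit_iff_omega0_dvd.2 ⟨c, hsucc⟩)

/-- The greatest `ε` such that `ω ^ ε` divides `γ`, i.e. the last exponent of the Cantor normal form
of `γ`; it is the Cantor–Bendixson rank of `γ ≠ 0` in the order topology. -/
noncomputable def lastExp (γ : Ordinal.{u}) : Ordinal.{u} := sSup {ε | ω ^ ε ∣ γ}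

lemma lastExp_omega0_opow_mul_succ (ε ξ : Ordinal.{u}) : lastExp (ω ^ ε * succ ξ) = ε := by
  have hset : {δ | ω ^ δ ∣ ω ^ ε * succ ξ} = Set.Iic ε :=
    Set.ext fun δ => omega0_opow_dvd_omega0_opow_mul_succ
  rw [lastExp, hset, csSup_Iic]

lemma lastExp_omega0_opow (ε : Ordinal.{u}) : lastExp (ω ^ ε) = ε := by
  simpa using lastExp_omega0_opow_mul_succ ε 0

lemma omega0_opow_dvd_iff_le_lastExp {γ δ : Ordinal.{u}} (hγ : γ ≠ 0) :
    ω ^ δ ∣ γ ↔ δ ≤ lastExp γ := by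
  obtain ⟨ε, ξ, rfl⟩ := exists_eq_omega0_opow_mul_succ hγ
  rw [omega0_opow_dvd_omega0_opow_mul_succ, lastExp_omega0_opow_mul_succ]

lemma exists_forall_lastExp_lt {γ : Ordinal.{u}} (hγ : γ ≠ 0) :
    ∃ a < γ, ∀ γ', a < γ' → γ' < γ → lastExp γ' < lastExp γ := by
  obtain ⟨ε, ξ, rfl⟩ := exists_eq_omega0_opow_mul_succ hγ
  have hpos : (0 : Ordinal.{u}) < ω ^ ε := opow_pos _ omega0_pos
  refine ⟨ω ^ ε * ξ, (mul_lt_mul_iff_of_pos_left hpos).2 (lt_succ ξ), fun γ' h₁ h₂ => ?_⟩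
  rw [lastExp_omega0_opow_mul_succ]
  by_contra! hle
  obtain ⟨c, rfl⟩ := (omega0_opow_dvd_iff_le_lastExp (ne_bot_of_gt h₁)).2 hle
  rw [mul_lt_mul_iff_of_pos_left hpos] at h₁ h₂
  exact h₁.not_ge (lt_succ_iff.1 h₂)

lemma exists_lastExp_eq {γ ε a : Ordinal.{u}} (hγ : γ ≠ 0) (hε : ε < lastExp γ) (ha : a < γ) :
    ∃ γ', a < γ' ∧ γ' < γ ∧ lastExp γ' = ε := by
  have hpos : (0 : Ordinal.{u}) < ω ^ ε := opow_pos _ omega0_pos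
  have hlast := lastExp_omega0_opow_mul_succ ε (a / ω ^ ε)
  refine ⟨ω ^ ε * succ (a / ω ^ ε), lt_mul_succ_div a hpos.ne',
    lt_of_le_of_ne ?_ fun e => (e ▸ hε).ne hlast.symm, hlast⟩
  obtain ⟨ζ, rfl⟩ := (omega0_opow_dvd_iff_le_lastExp hγ).2 hε.le
  rw [mul_le_mul_iff_of_pos_left hpos]
  exact succ_le_of_lt ((lt_mul_iff_div_lt hpos.ne').1 ha)

lemma lastExp_le {γ κ : Ordinal.{u}} (hγ : γ ≠ 0) (h : γ ≤ ω ^ κ) : lastExp γ ≤ κ :=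
  (opow_le_opow_iff_right one_lt_omega0).1
    ((le_of_dvd hγ ((omega0_opow_dvd_iff_le_lastExp hγ).2 le_rfl)).trans h)

lemma eq_omega0_opow_of_lastExp_eq {γ κ : Ordinal.{u}} (hγ : γ ≠ 0) (h : γ ≤ ω ^ κ)
    (e : lastExp γ = κ) : γ = ω ^ κ :=
  le_antisymm h (le_of_dvd hγ ((omega0_opow_dvd_iff_le_lastExp hγ).2 e.ge))

lemma mul_add_lt_mul_add {μ δ δ' y y' : Ordinal.{u}} (hδ : δ < δ') (hyμ : y ≤ μ) (hy' : 0 < y') :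
    μ * δ + y < μ * δ' + y' :=
  calc μ * δ + y ≤ μ * δ + μ := by gcongr
    _ = μ * succ δ := (mul_succ _ _).symm
    _ ≤ μ * δ' := by gcongr; exact succ_le_of_lt hδ
    _ < μ * δ' + y' := lt_add_of_pos_right _ hy'

lemma eq_of_mul_add_eq_mul_add {μ δ δ' y y' : Ordinal.{u}} (h : μ * δ + y = μ * δ' + y')
    (hy : 0 < y) (hyμ : y ≤ μ) (hy' : 0 < y') (hyμ' : y' ≤ μ) : y = y' := by
  rcases lt_trichotomy δ δ' with hlt | rfl | hlt
  · exact absurd h (mul_add_lt_mul_add hlt hyμ hy').ne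
  · exact add_left_cancel h
  · exact absurd h (mul_add_lt_mul_add hlt hyμ' hy).ne'

lemma not_mul_omega0_dvd_mul_add {μ δ y : Ordinal.{u}} (hy : 0 < y) (hyμ : y ≤ μ) :
    ¬ μ * ω ∣ μ * δ + y := by
  rintro ⟨c, hc⟩
  have hμ : 0 < μ := hy.trans_le hyμ
  rw [mul_assoc] at hc
  have hδ : δ < ω * c :=
    (mul_lt_mul_iff_of_pos_left hμ).1 (hc ▸ lt_add_of_pos_right _ hy)
  have hlim : IsSuccLimit (ω * c) :=
    isSuccLimit_iff.2 ⟨ne_bot_of_gt hδ, isSuccPrelimit_iff_omega0_dvd.2 (dvd_mul_right _ _)⟩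
  have hle : μ * δ + y ≤ μ * succ δ := by
    rw [mul_succ]
    gcongr
  rw [hc, mul_le_mul_iff_of_pos_left hμ] at hle
  exact (hlim.succ_lt hδ).not_ge hle

lemma exists_eq_mul_add {μ x : Ordinal.{u}} (hμ : μ ≠ 0) (hx : ¬ μ * ω ∣ x) :
    ∃ δ y, 0 < y ∧ y ≤ μ ∧ x = μ * δ + y := by
  have hdec := div_add_mod x μ
  by_cases h0 : x % μ = 0
  · rw [h0, add_zero] at hdec
    have hnl : ¬ ω ∣ x / μ := fun ⟨c, hc⟩ => hx ⟨c, by rw [mul_assoc, ← hc, hdec]⟩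
    rcases zero_or_succ_or_isSuccLimit (x / μ) with h | ⟨ξ, hξ⟩ | hl
    · exact absurd (h ▸ dvd_zero ω) hnl
    · exact ⟨ξ, μ, pos_iff_ne_zero.2 hμ, le_rfl, by rw [← mul_succ, hξ, hdec]⟩
    · exact absurd (isSuccPrelimit_iff_omega0_dvd.1 hl.isSuccPrelimit) hnl
  · exact ⟨x / μ, x % μ, pos_iff_ne_zero.2 h0, (mod_lt _ hμ).le, hdec.symm⟩

end Arithmetic

lemma induced_val_Icc {α : Type w} [LinearOrder α] [TopologicalSpace α] [OrderTopology α]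
    (a b : α) : TopologicalSpace.induced (Subtype.val : Set.Icc a b → α) inferInstance =
      Preorder.topology (Set.Icc a b) :=
  (orderTopology_of_ordConnected (t := Set.Icc a b)).topology_eq_generate_intervals

lemma isOpen_Icc_Ioc {lam : Ordinal.{u}} (a b : Ordinal.{u}) :
    IsOpen[Preorder.topology (Set.Icc 1 lam)] {y | a < y.1 ∧ y.1 ≤ b} := by
  rw [← induced_val_Icc]
  refine ⟨Set.Ioo a (Order.succ b), isOpen_Ioo, ?_⟩
  ext y
  simp

lemma exists_Ioc_subset_of_isOpen_Icc {lam : Ordinal.{u}} {U : Set (Set.Icc 1 lam)}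
    (hU : IsOpen[Preorder.topology (Set.Icc 1 lam)] U) {x : Set.Icc 1 lam} (hx : x ∈ U) :
    ∃ a < x.1, ∀ y : Set.Icc 1 lam, a < y.1 → y.1 ≤ x.1 → y ∈ U := by
  rw [← induced_val_Icc] at hU
  obtain ⟨V, hV, rfl⟩ := hU
  obtain ⟨a, ha, h⟩ := exists_Ioc_subset_of_mem_nhds (hV.mem_nhds hx)
    ⟨0, zero_lt_one.trans_le x.2.1⟩
  exact ⟨a, ha, fun y h₁ h₂ => h ⟨h₁, h₂⟩⟩

lemma isScattered_Icc (lam : Ordinal.{u}) : IsScattered (Preorder.topology (Set.Icc 1 lam)) := by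
  intro A hA
  obtain ⟨x, hx, hmin⟩ := (wellFounded_lt (α := Set.Icc 1 lam)).has_min A hA
  refine ⟨x, hx, _, isOpen_Icc_Ioc 0 x.1, Set.eq_singleton_iff_unique_mem.2
    ⟨⟨⟨zero_lt_one.trans_le x.2.1, le_rfl⟩, hx⟩, ?_⟩⟩
  rintro y ⟨⟨-, hyx⟩, hy⟩
  exact le_antisymm hyx (not_lt.1 (hmin y hy))

lemma compactSpace_Icc (lam : Ordinal.{u}) :
    @CompactSpace (Set.Icc 1 lam) (Preorder.topology (Set.Icc 1 lam)) := by
  rw [← induced_val_Icc]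
  exact isCompact_iff_compactSpace.1 isCompact_Icc

/-- Translation by `a`, as a map from the interval `[1, μ]` to `[1, lam]`. -/
def shift {a μ lam : Ordinal.{u}} (h : a + μ ≤ lam) (y : Set.Icc 1 μ) : Set.Icc 1 lam :=
  ⟨a + y.1, y.2.1.trans le_add_self, (by gcongr; exact y.2.2 : a + y.1 ≤ a + μ).trans h⟩

lemma strictMono_shift {a μ lam : Ordinal.{u}} (h : a + μ ≤ lam) : StrictMono (shift h) :=
  fun _ _ hxy => Subtype.coe_lt_coe.1 <| add_lt_add_right (Subtype.coe_lt_coe.2 hxy) a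

lemma range_shift {a μ lam : Ordinal.{u}} (h : a + μ ≤ lam) :
    Set.range (shift h) = {y | a < y.1 ∧ y.1 ≤ a + μ} := by
  ext x
  constructor
  · rintro ⟨y, rfl⟩
    exact ⟨lt_add_of_pos_right _ (zero_lt_one.trans_le y.2.1), add_le_add_right y.2.2 a⟩
  · rintro ⟨h₁, h₂⟩
    refine ⟨⟨x.1 - a, ?_, Ordinal.sub_le.2 h₂⟩,
      Subtype.ext (Ordinal.add_sub_cancel_of_le h₁.le)⟩
    rwa [Order.one_le_iff_pos, ← not_le, Ordinal.sub_le, add_zero, not_le]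

lemma isOpenInj_shift {a μ lam : Ordinal.{u}} (h : a + μ ≤ lam) :
    IsOpenInj (Preorder.topology (Set.Icc 1 lam)) (shift h) :=
  ⟨(strictMono_shift h).injective, range_shift h ▸ isOpen_Icc_Ioc _ _⟩

lemma induced_shift {a μ lam : Ordinal.{u}} (h : a + μ ≤ lam) :
    TopologicalSpace.induced (shift h) (Preorder.topology (Set.Icc 1 lam)) =
      Preorder.topology (Set.Icc 1 μ) := by
  let _ := Preorder.topology (Set.Icc 1 lam)
  have : OrderTopology (Set.Icc 1 lam) := ⟨rfl⟩
  refine (strictMono_shift h).induced_topology_eq_preorder ?_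
  rw [range_shift]
  exact ⟨fun _ hx _ hy _ hz => ⟨hx.1.trans_le hz.1, (Subtype.coe_le_coe.2 hz.2).trans hy.2⟩⟩

/-- `C` is the base of a cone over `(Y, σ)` inside `(Z, τ)`: the open complement of `C` is folded
onto `Y` by the `d`-map `c`, and every fibre of `c` accumulates at every point of `C`. -/
structure IsCone {Z Y : Type u} (τ : TopologicalSpace Z) (σ : TopologicalSpace Y) (C : Set Z)
    (c : ↥Cᶜ → Y) : Prop where
  isOpen_compl : IsOpen[τ] Cᶜ
  isDMap : IsDMap (TopologicalSpace.induced Subtype.val τ) σ c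
  exists_fiber : ∀ x ∈ C, ∀ U, IsOpen[τ] U → x ∈ U → ∀ y, ∃ o : ↥Cᶜ, o.1 ∈ U ∧ c o = y

lemma IsRankFn.exists_range_eq_Iio {τ : TopologicalSpace X} (hc : @CompactSpace X τ)
    {h : X → Ordinal.{u}} (H : IsRankFn τ h) :
    ∃ η, ¬ Order.IsSuccLimit η ∧ Set.range h = Set.Iio η := by
  have hlower : IsLowerSet (Set.range h) := by
    rintro _ β hβ ⟨x, rfl⟩
    rcases hβ.eq_or_lt with rfl | hlt
    · exact ⟨x, rfl⟩
    · obtain ⟨y, -, e⟩ := H.hit x Set.univ isOpen_univ trivial β hlt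
      exact ⟨y, e⟩
  rcases hlower.eq_univ_or_Iio with huniv | ⟨η, hη⟩
  · exact absurd (huniv ▸ Ordinal.bddAbove_of_small (s := Set.range h)) not_bddAbove_univ
  refine ⟨η, fun hl => ?_, hη⟩
  have : Nonempty (Set.Iio η) := ⟨⟨0, pos_iff_ne_zero.2 hl.ne_bot⟩⟩
  obtain ⟨α, hα⟩ := isCompact_univ.elim_directed_cover (fun α : Set.Iio η => {y | h y < α.1})
    (fun α => H.isOpen_lt α.1)
    (fun y _ => Set.mem_iUnion.2
      ⟨⟨Order.succ (h y), hl.succ_lt (hη.subset ⟨y, rfl⟩)⟩, Order.lt_succ (h y)⟩)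
    (directed_of_isDirected_le fun _ _ hab _ (hy : h _ < _) => hy.trans_le hab)
  obtain ⟨y, hy⟩ := hη.superset α.2
  exact (hα (Set.mem_univ y) : h y < α.1).ne hy

lemma IsRankFn.typein {L : Type v} [LinearOrder L] [WellFoundedLT L] {τ : TopologicalSpace X}
    {r : X → L} (H : IsRankFn τ r) :
    IsRankFn τ fun x => Ordinal.typein (α := L) (· < ·) (r x) := by
  refine ⟨fun x => ?_, fun x U hU hx β hβ => ?_⟩
  · obtain ⟨U, hU, hxU, hlt⟩ := H.lt x
    exact ⟨U, hU, hxU, fun y hy hne => (Ordinal.typein_lt_typein _).2 (hlt y hy hne)⟩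
  · obtain ⟨b, rfl⟩ := Ordinal.typein_surj (α := L) (· < ·)
      (hβ.trans (Ordinal.typein_lt_type (· < ·) (r x)))
    obtain ⟨y, hy, rfl⟩ := H.hit x U hU hx b ((Ordinal.typein_lt_typein _).1 hβ)
    exact ⟨y, hy, rfl⟩

lemma strictMono_add_typein (η : Ordinal.{u}) (L : Type u) [LinearOrder L] [WellFoundedLT L] :
    StrictMono fun l : L => η + Ordinal.typein (α := L) (· < ·) l :=
  fun _ _ hl => (add_lt_add_iff_left η).2 ((Ordinal.typein_lt_typein _).2 hl)

lemma ordConnected_range_add_typein (η : Ordinal.{u}) (L : Type u) [LinearOrder L]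
    [WellFoundedLT L] :
    (Set.range fun l : L => η + Ordinal.typein (α := L) (· < ·) l).OrdConnected := by
  refine ⟨?_⟩
  rintro _ ⟨a, rfl⟩ _ ⟨b, rfl⟩ β ⟨haβ, hβb⟩
  have hβ : η + (β - η) = β := Ordinal.add_sub_cancel_of_le (le_self_add.trans haβ)
  rw [← hβ, add_le_add_iff_left] at hβb
  obtain ⟨l, hl⟩ := Ordinal.typein_surj (α := L) (· < ·)
    (hβb.trans_lt (Ordinal.typein_lt_type (· < ·) b))
  exact ⟨l, by rw [← hβ, ← hl]⟩

namespace IsCone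

variable {Z Y : Type u} {τ τ' : TopologicalSpace Z} {σ σ' : TopologicalSpace Y} {C : Set Z}
  {c : ↥Cᶜ → Y} {η : Ordinal.{w}}

lemma isOpenInj_compl (hC : IsCone τ σ C c) : IsOpenInj τ (Subtype.val : ↥Cᶜ → Z) :=
  ⟨Subtype.val_injective, by simpa only [Subtype.range_coe] using hC.isOpen_compl⟩

lemma exists_isRankFn (hC : IsCone τ σ C c) {h' : Y → Ordinal.{w}} {e : C → Ordinal.{w}}
    (H' : IsRankFn σ h') (hη : Set.range h' = Set.Iio η)
    (He : IsRankFn (TopologicalSpace.induced Subtype.val τ) e) :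
    ∃ h : Z → Ordinal.{w}, IsRankFn τ h ∧ (∀ x : C, h x = η + e x) ∧
      ∀ x : ↥Cᶜ, h x = h' (c x) := by
  classical
  let h (x : Z) : Ordinal.{w} := if hx : x ∈ C then η + e ⟨x, hx⟩ else h' (c ⟨x, hx⟩)
  have hbase : ∀ x : C, h x = η + e x := fun x => dif_pos x.2
  have hfold : ∀ x : ↥Cᶜ, h x = h' (c x) := fun x => dif_neg x.2
  have hlt : ∀ x : ↥Cᶜ, h x < η := fun x => hfold x ▸ hη.subset ⟨c x, rfl⟩
  have Hc := H'.comp_isDMap hC.isDMap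
  refine ⟨h, ⟨fun x => ?_, fun x U hU hx β hβ => ?_⟩, hbase, hfold⟩
  all_goals by_cases hxC : x ∈ C
  · obtain ⟨_, ⟨U, hU, rfl⟩, hxU, hlt'⟩ := He.lt ⟨x, hxC⟩
    refine ⟨U, hU, hxU, fun y hy hne => ?_⟩
    rw [hbase ⟨x, hxC⟩]
    by_cases hyC : y ∈ C
    · rw [hbase ⟨y, hyC⟩]
      gcongr
      exact hlt' ⟨y, hyC⟩ hy fun e => hne (congrArg Subtype.val e)
    · exact (hlt ⟨y, hyC⟩).trans_le le_self_add
  · obtain ⟨U, hU, hxU, hlt'⟩ := Hc.lt ⟨x, hxC⟩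
    refine ⟨_, hC.isOpenInj_compl.isOpen_induced.1 hU, ⟨_, hxU, rfl⟩, ?_⟩
    rintro _ ⟨y, hy, rfl⟩ hne
    rw [hfold y, hfold ⟨x, hxC⟩]
    exact hlt' y hy fun e => hne (congrArg Subtype.val e)
  · rcases lt_or_ge β η with hβη | hηβ
    · obtain ⟨y, rfl⟩ := hη.superset hβη
      obtain ⟨o, ho, rfl⟩ := hC.exists_fiber x hxC U hU hx y
      exact ⟨o.1, ho, hfold o⟩
    · have hsub := Ordinal.add_sub_cancel_of_le hηβ
      rw [hbase ⟨x, hxC⟩, ← hsub, add_lt_add_iff_left] at hβ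
      obtain ⟨y, hy, e⟩ := He.hit ⟨x, hxC⟩ (Subtype.val ⁻¹' U) ⟨U, hU, rfl⟩ hx _ hβ
      exact ⟨y.1, hy, by rw [hbase y, e, hsub]⟩
  · rw [hfold ⟨x, hxC⟩] at hβ
    obtain ⟨y, hy, e⟩ := Hc.hit ⟨x, hxC⟩ (Subtype.val ⁻¹' U) ⟨U, hU, rfl⟩ hx β hβ
    exact ⟨y.1, hy, (hfold y).trans e⟩

/-- A `τ'`-neighbourhood of a base point contains a point of rank `η`. As `η` is not a limit, it is
a `τ`-neighbourhood of that point. -/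
lemma of_isLExtension {η : Ordinal.{u}} (hC : IsCone τ σ C c) {h : Z → Ordinal.{u}}
    (H : IsRankFn τ h) (hη : ¬ Order.IsSuccLimit η) (hCη : ∀ x, x ∈ C ↔ η ≤ h x)
    (hτ : IsLExtension τ τ') (hc : IsDMap (TopologicalSpace.induced Subtype.val τ') σ' c) :
    IsCone τ' σ' C c := by
  refine ⟨hτ.extends_base _ hC.isOpen_compl, hc, fun x hx U hU hxU y => ?_⟩
  obtain ⟨z, hzU, hz⟩ : ∃ z ∈ U, h z = η := by
    rcases ((hCη x).1 hx).eq_or_lt with e | hlt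
    · exact ⟨x, hxU, e.symm⟩
    · exact (hτ.isRankFn H).hit x U hU hxU η hlt
  obtain ⟨V, hV, hzV, hVU⟩ := hτ.nhds_of_not_limit U hU z hzU (by rwa [H.rank_eq, hz])
  obtain ⟨o, ho, e⟩ := hC.exists_fiber z ((hCη z).2 hz.ge) V hV hzV y
  exact ⟨o, hVU ho, e⟩

theorem exists_isLMESeq (hC : IsCone τ σ C c) (hσ : @CompactSpace Y σ) {L : Type u} [LinearOrder L]
    [WellFoundedLT L] {r : C → L} (Hr : IsRankFn (TopologicalSpace.induced Subtype.val τ) r)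
    {υ : ℕ → TopologicalSpace Y} {θ : ℕ → TopologicalSpace L} (hυ : IsLMESeq σ υ)
    (hθ : IsLMESeq (Preorder.topology L) θ) :
    ∃ τ' : ℕ → TopologicalSpace Z, IsLMESeq τ τ' ∧ IsCone (τ' 0) (υ 0) C c ∧
      (∀ k, IsDMap (TopologicalSpace.induced Subtype.val (τ' k)) (υ k) c) ∧
      ∀ k, IsOpenInj (τ' (k + 1)) (Subtype.val : C → Z) ∧
        IsDMap (TopologicalSpace.induced Subtype.val (τ' (k + 1))) (θ k) r := by
  obtain ⟨η, hη, hrange⟩ := hυ.scattered_base.isRankFn.exists_range_eq_Iio hσ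
  obtain ⟨h, H, hbase, hfold⟩ :=
    hC.exists_isRankFn hυ.scattered_base.isRankFn hrange Hr.typein
  have hCη (x : Z) : x ∈ C ↔ η ≤ h x := by
    refine ⟨fun hx => (hbase ⟨x, hx⟩).symm ▸ le_self_add, fun hx => by_contra fun hxC => ?_⟩
    exact (hfold ⟨x, hxC⟩ ▸ hx).not_gt (hrange.subset ⟨c ⟨x, hxC⟩, rfl⟩)
  obtain ⟨τ₀, hτ₀, hc₀⟩ := hC.isDMap.exists_isLMaximalLExtension hC.isOpenInj_compl H.isScattered
    hυ.scattered_base hυ.zero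
  have H₀ := hτ₀.1.isRankFn H
  have hi₁ := hC.isOpenInj_compl.mono hτ₀.1.extends_base
  have hi₂ : IsOpenInj (nextTopology τ₀) (Subtype.val : C → Z) := by
    refine ⟨Subtype.val_injective, ?_⟩
    rw [Subtype.range_coe, (Set.ext hCη : C = {x | η ≤ h x})]
    exact H₀.isOpen_nextTopology_ge hη
  have hr : IsDMap (TopologicalSpace.induced Subtype.val (nextTopology τ₀))
      (Preorder.topology L) r :=
    hτ₀.2.isDMap_induced_nextTopology H₀ Subtype.val_injective (strictMono_add_typein η L)
      (ordConnected_range_add_typein η L) hbase (by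
        rintro x ⟨l, hl⟩
        rw [Subtype.range_coe, hCη, ← hl]
        exact le_self_add)
  obtain ⟨τ', hτ', hc', hr'⟩ := exists_isLMESeq_lift (H₀.isScattered.mono (nextTopology_le τ₀))
    (hi₁.mono (nextTopology_le τ₀)) hi₂
    (by simpa only [Subtype.range_coe] using disjoint_compl_left)
    (hc₀.nextTopology hi₁ H₀.isScattered (hυ.isScattered 0) hτ₀.2 (hυ.isLMaximal 0)) hr
    hυ.tail hθ
  refine ⟨_, hτ'.cons H.isScattered hτ₀, hC.of_isLExtension H hη hCη hτ₀.1 hc₀, fun k => ?_,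
    fun k => ⟨hi₂.mono (hτ'.le_base k), hr' k⟩⟩
  cases k with
  | zero => exact hc₀
  | succ k => exact hc' k

end IsCone

section OrdinalCone

open Ordinal Order

variable {μ κ : Ordinal.{u}}

/-- The order type of one block of the cone over `[1, μ]`: `ω` copies of `[1, μ]`, or a single
point if `μ = 0`. -/
noncomputable def blockLength (μ : Ordinal.{u}) : Ordinal.{u} := max 1 (μ * ω)

/-- The interval `[1, coneLength μ κ]` consists of `ω ^ κ` blocks; it carries a cone over
`[1, μ]`. -/
noncomputable def coneLength (μ κ : Ordinal.{u}) : Ordinal.{u} := blockLength μ * ω ^ κ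

/-- The base of the cone: the end points of the blocks. -/
def coneBase (μ κ : Ordinal.{u}) : Set (Set.Icc 1 (coneLength μ κ)) := {x | blockLength μ ∣ x.1}

lemma blockLength_pos (μ : Ordinal.{u}) : 0 < blockLength μ :=
  zero_lt_one.trans_le (le_max_left _ _)

lemma blockLength_eq (hμ : μ ≠ 0) : blockLength μ = μ * ω :=
  max_eq_right (one_le_iff_ne_zero.2 (mul_ne_zero hμ omega0_ne_zero))

lemma coneLength_pos (μ κ : Ordinal.{u}) : 0 < coneLength μ κ :=
  mul_pos (blockLength_pos μ) (opow_pos κ omega0_pos)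

lemma coneLength_lt_epsilon {o : Ordinal.{u}} (hμ : μ < epsilon o) (hκ : κ < epsilon o) :
    coneLength μ κ < epsilon o := by
  have hω := omega0_lt_epsilon o
  exact isPrincipal_mul_epsilon o (max_lt (one_lt_omega0.trans hω)
    (isPrincipal_mul_epsilon o hμ hω)) (omega0_opow_lt_epsilon hκ)

lemma exists_eq_blockLength_mul {x : Set.Icc 1 (coneLength μ κ)} (hx : x ∈ coneBase μ κ) :
    ∃ γ ≠ 0, γ ≤ ω ^ κ ∧ x.1 = blockLength μ * γ := by
  obtain ⟨γ, hγ⟩ := hx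
  refine ⟨γ, ?_, (mul_le_mul_iff_of_pos_left (blockLength_pos μ)).1 (hγ ▸ x.2.2), hγ⟩
  rintro rfl
  exact (zero_lt_one.trans_le x.2.1).ne' (hγ.trans (mul_zero _))

lemma isOpen_compl_coneBase :
    IsOpen[Preorder.topology (Set.Icc 1 (coneLength μ κ))] (coneBase μ κ)ᶜ := by
  have hpos := blockLength_pos μ
  refine isOpen_of_forall_exists_subset fun x hx =>
    ⟨_, isOpen_Icc_Ioc (blockLength μ * (x.1 / blockLength μ)) x.1,
      ⟨(mul_div_le _ _).lt_of_ne fun h => hx ⟨_, h.symm⟩, le_rfl⟩, ?_⟩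
  rintro y ⟨h₁, h₂⟩ ⟨γ, hγ⟩
  have h₃ := h₂.trans_lt (lt_mul_succ_div x.1 hpos.ne')
  rw [hγ, mul_lt_mul_iff_of_pos_left hpos] at h₁ h₃
  exact h₁.not_ge (lt_succ_iff.1 h₃)

lemma shift_notMem_coneBase {δ : Ordinal.{u}} (h : μ * δ + μ ≤ coneLength μ κ)
    (y : Set.Icc 1 μ) : shift h y ∉ coneBase μ κ := by
  have hy : 0 < y.1 := one_le_iff_pos.1 y.2.1
  change ¬ blockLength μ ∣ μ * δ + y.1
  rw [blockLength_eq (hy.trans_le y.2.2).ne']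
  exact not_mul_omega0_dvd_mul_add hy y.2.2

lemma exists_shift_eq (x : ↥(coneBase μ κ)ᶜ) :
    ∃ (y : Set.Icc 1 μ) (δ : Ordinal.{u}) (h : μ * δ + μ ≤ coneLength μ κ), shift h y = x.1 := by
  obtain ⟨x, hx⟩ := x
  have hμ : μ ≠ 0 := by
    rintro rfl
    exact hx (by simp [coneBase, blockLength])
  have hx' : ¬ μ * ω ∣ x.1 := blockLength_eq hμ ▸ hx
  obtain ⟨δ, y, hy, hyμ, hxy⟩ := exists_eq_mul_add hμ hx'
  have hδ : μ * δ < μ * (ω * ω ^ κ) := by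
    rw [← mul_assoc, ← blockLength_eq hμ]
    exact (hxy ▸ lt_add_of_pos_right _ hy : μ * δ < x.1).trans_le x.2.2
  refine ⟨⟨y, one_le_iff_pos.2 hy, hyμ⟩, δ, ?_, Subtype.ext hxy.symm⟩
  rw [← mul_succ, coneLength, blockLength_eq hμ, mul_assoc]
  gcongr
  exact succ_le_of_lt ((mul_lt_mul_iff_of_pos_left (pos_iff_ne_zero.2 hμ)).1 hδ)

/-- The map folding the copies of `[1, μ]` that make up the complement of the base onto
`[1, μ]`. -/
noncomputable def coneFold (x : ↥(coneBase μ κ)ᶜ) : Set.Icc 1 μ := (exists_shift_eq x).choose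

lemma exists_shift_coneFold (x : ↥(coneBase μ κ)ᶜ) :
    ∃ (δ : Ordinal.{u}) (h : μ * δ + μ ≤ coneLength μ κ), shift h (coneFold x) = x.1 :=
  (exists_shift_eq x).choose_spec

lemma coneFold_eq_of_shift_eq {x : ↥(coneBase μ κ)ᶜ} {δ : Ordinal.{u}}
    (h : μ * δ + μ ≤ coneLength μ κ) {y : Set.Icc 1 μ} (hy : shift h y = x.1) :
    coneFold x = y := by
  obtain ⟨δ', h', hx⟩ := exists_shift_coneFold x
  exact Subtype.ext (eq_of_mul_add_eq_mul_add (congrArg Subtype.val (hx.trans hy.symm))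
    (one_le_iff_pos.1 (coneFold x).2.1) (coneFold x).2.2 (one_le_iff_pos.1 y.2.1) y.2.2)

lemma isOpenInj_compl_coneBase : IsOpenInj (Preorder.topology (Set.Icc 1 (coneLength μ κ)))
    (Subtype.val : ↥(coneBase μ κ)ᶜ → _) :=
  ⟨Subtype.val_injective, by simpa only [Subtype.range_coe] using isOpen_compl_coneBase⟩

lemma isDMap_coneFold : IsDMap
    (TopologicalSpace.induced Subtype.val (Preorder.topology (Set.Icc 1 (coneLength μ κ))))
    (Preorder.topology (Set.Icc 1 μ)) (coneFold (μ := μ) (κ := κ)) := by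
  refine isDMap_iff.2 ⟨fun V hV => ?_, fun U hU => ?_, fun x => ?_⟩
  · refine isOpenInj_compl_coneBase.isOpen_induced.2 (isOpen_of_forall_exists_subset ?_)
    rintro _ ⟨x, hx, rfl⟩
    obtain ⟨δ, h, hxδ⟩ := exists_shift_coneFold x
    refine ⟨shift h '' V, (isOpenInj_shift h).isOpen_induced.1 (by rwa [induced_shift]),
      ⟨_, hx, hxδ⟩, ?_⟩
    rintro _ ⟨y, hy, rfl⟩
    refine ⟨⟨_, shift_notMem_coneBase h y⟩, ?_, rfl⟩
    rwa [Set.mem_preimage, coneFold_eq_of_shift_eq h rfl]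
  · rw [isOpenInj_compl_coneBase.isOpen_induced] at hU
    refine isOpen_of_forall_exists_subset ?_
    rintro _ ⟨x, hx, rfl⟩
    obtain ⟨δ, h, hxδ⟩ := exists_shift_coneFold x
    refine ⟨shift h ⁻¹' (Subtype.val '' U), ?_, ⟨x, hx, hxδ.symm⟩, ?_⟩
    · rw [← induced_shift h]
      exact ⟨_, hU, rfl⟩
    · rintro y ⟨z, hz, hzy⟩
      exact ⟨z, hz, coneFold_eq_of_shift_eq h hzy.symm⟩
  · obtain ⟨δ, h, hxδ⟩ := exists_shift_coneFold x
    refine ⟨Subtype.val ⁻¹' Set.range (shift h), ⟨_, (isOpenInj_shift h).isOpen_range, rfl⟩,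
      ⟨_, hxδ⟩, ?_⟩
    rintro z ⟨y, hy⟩ hzx
    rw [coneFold_eq_of_shift_eq h hy] at hzx
    exact Subtype.ext (by rw [← hy, hzx, hxδ])

lemma exists_coneFold_eq {x : Set.Icc 1 (coneLength μ κ)} (hx : x ∈ coneBase μ κ)
    {U : Set (Set.Icc 1 (coneLength μ κ))} (hU : IsOpen[Preorder.topology _] U) (hxU : x ∈ U)
    (y : Set.Icc 1 μ) : ∃ o : ↥(coneBase μ κ)ᶜ, o.1 ∈ U ∧ coneFold o = y := by
  obtain ⟨γ, hγ, -, hxγ⟩ := exists_eq_blockLength_mul hx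
  obtain ⟨a, ha, haU⟩ := exists_Ioc_subset_of_isOpen_Icc hU hxU
  have hμ : 0 < μ := (one_le_iff_pos.1 y.2.1).trans_le y.2.2
  rw [hxγ, blockLength_eq hμ.ne', mul_assoc] at ha
  have hlim : IsSuccLimit (ω * γ) := isSuccLimit_mul_left isSuccLimit_omega0 (pos_iff_ne_zero.2 hγ)
  have hlt : succ (succ (a / μ)) < ω * γ :=
    hlim.succ_lt (hlim.succ_lt ((lt_mul_iff_div_lt hμ.ne').1 ha))
  have hle : μ * succ (a / μ) + μ ≤ x.1 := by
    rw [← mul_succ, hxγ, blockLength_eq hμ.ne', mul_assoc]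
    gcongr
  refine ⟨⟨shift (hle.trans x.2.2) y, shift_notMem_coneBase _ y⟩, haU _ ?_ ?_,
    coneFold_eq_of_shift_eq (hle.trans x.2.2) rfl⟩
  · exact (lt_mul_succ_div a hμ.ne').trans_le le_self_add
  · exact (add_le_add_right y.2.2 _).trans hle

theorem isCone_coneBase : IsCone (Preorder.topology (Set.Icc 1 (coneLength μ κ)))
    (Preorder.topology (Set.Icc 1 μ)) (coneBase μ κ) coneFold :=
  ⟨isOpen_compl_coneBase, isDMap_coneFold, fun _ hx _ hU hxU y => exists_coneFold_eq hx hU hxU y⟩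

/-- The Cantor–Bendixson rank within the base of the cone, increased by `1` to take values in
`[1, 1 + κ]`. -/
noncomputable def coneRank (x : coneBase μ κ) : Set.Icc 1 (1 + κ) :=
  ⟨1 + lastExp (x.1.1 / blockLength μ), le_self_add, by
    obtain ⟨γ, hγ, hle, hxγ⟩ := exists_eq_blockLength_mul x.2
    rw [hxγ, mul_div_cancel γ (blockLength_pos μ).ne']
    gcongr
    exact lastExp_le hγ hle⟩

lemma coneRank_of_eq {x : coneBase μ κ} {γ : Ordinal.{u}} (hx : x.1.1 = blockLength μ * γ) :
    (coneRank x).1 = 1 + lastExp γ := by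
  change 1 + lastExp (x.1.1 / blockLength μ) = _
  rw [hx, mul_div_cancel γ (blockLength_pos μ).ne']

lemma exists_coneRank_eq {x : coneBase μ κ} {U : Set (Set.Icc 1 (coneLength μ κ))}
    (hU : IsOpen[Preorder.topology _] U) (hxU : x.1 ∈ U) {β : Set.Icc 1 (1 + κ)}
    (hβ : β < coneRank x) : ∃ y : coneBase μ κ, y.1 ∈ U ∧ coneRank y = β := by
  have hpos := blockLength_pos μ
  obtain ⟨γ, hγ, -, hxγ⟩ := exists_eq_blockLength_mul x.2
  obtain ⟨a, ha, haU⟩ := exists_Ioc_subset_of_isOpen_Icc hU hxU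
  have hβ' : 1 + (β.1 - 1) = β.1 := Ordinal.add_sub_cancel_of_le β.2.1
  rw [← Subtype.coe_lt_coe, coneRank_of_eq hxγ, ← hβ', add_lt_add_iff_left] at hβ
  rw [hxγ, lt_mul_iff_div_lt hpos.ne'] at ha
  obtain ⟨γ', haγ', hγ', hlast⟩ := exists_lastExp_eq hγ hβ ha
  have hle : blockLength μ * γ' ≤ x.1.1 := by
    rw [hxγ]
    gcongr
  have hmem : blockLength μ * γ' ∈ Set.Icc 1 (coneLength μ κ) :=
    ⟨one_le_iff_pos.2 (mul_pos hpos (bot_le.trans_lt haγ')), hle.trans x.1.2.2⟩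
  refine ⟨⟨⟨_, hmem⟩, dvd_mul_right _ _⟩, haU _ ?_ hle,
    Subtype.ext ((coneRank_of_eq rfl).trans (by rw [hlast, hβ']))⟩
  exact (lt_mul_succ_div a hpos.ne').trans_le (mul_le_mul_right (succ_le_of_lt haγ') _)

theorem isRankFn_coneRank : IsRankFn
    (TopologicalSpace.induced Subtype.val (Preorder.topology (Set.Icc 1 (coneLength μ κ))))
    (coneRank (μ := μ) (κ := κ)) := by
  have hpos := blockLength_pos μ
  refine ⟨fun x => ?_, ?_⟩
  · obtain ⟨γ, hγ, -, hxγ⟩ := exists_eq_blockLength_mul x.2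
    obtain ⟨a, ha, hlt⟩ := exists_forall_lastExp_lt hγ
    refine ⟨_, ⟨_, isOpen_Icc_Ioc (blockLength μ * a) x.1.1, rfl⟩, ⟨?_, le_rfl⟩, ?_⟩
    · rwa [hxγ, mul_lt_mul_iff_of_pos_left hpos]
    · rintro y ⟨h₁, h₂⟩ hne
      obtain ⟨γ', -, -, hyγ⟩ := exists_eq_blockLength_mul y.2
      have h₃ : y.1.1 < x.1.1 := h₂.lt_of_ne fun e => hne (Subtype.ext (Subtype.ext e))
      rw [hyγ, mul_lt_mul_iff_of_pos_left hpos] at h₁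
      rw [hyγ, hxγ, mul_lt_mul_iff_of_pos_left hpos] at h₃
      rw [← Subtype.coe_lt_coe, coneRank_of_eq hyγ, coneRank_of_eq hxγ, add_lt_add_iff_left]
      exact hlt γ' h₁ h₃
  · rintro x _ ⟨U, hU, rfl⟩ hx β hβ
    exact exists_coneRank_eq hU hx hβ

lemma coneRank_eq_iff {x : coneBase μ κ} :
    (coneRank x).1 = 1 + κ ↔ x.1.1 = coneLength μ κ := by
  refine ⟨fun h => ?_, fun h => ?_⟩
  · obtain ⟨γ, hγ, hle, hxγ⟩ := exists_eq_blockLength_mul x.2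
    rw [coneRank_of_eq hxγ, add_right_inj] at h
    rw [hxγ, coneLength, eq_omega0_opow_of_lastExp_eq hγ hle h]
  · rw [coneRank_of_eq h, lastExp_omega0_opow]

/-- The last point of the cone. -/
noncomputable def coneApex (μ κ : Ordinal.{u}) : coneBase μ κ :=
  ⟨⟨coneLength μ κ, one_le_iff_pos.2 (coneLength_pos μ κ), le_rfl⟩, dvd_mul_right _ _⟩

lemma surjective_coneRank : Function.Surjective (coneRank (μ := μ) (κ := κ)) := by
  intro β
  have hapex : (coneRank (coneApex μ κ)).1 = 1 + κ := coneRank_eq_iff.2 rfl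
  have hle : β ≤ coneRank (coneApex μ κ) := Subtype.coe_le_coe.1 (β.2.2.trans_eq hapex.symm)
  rcases hle.eq_or_lt with e | hlt
  · exact ⟨_, e.symm⟩
  · obtain ⟨y, -, hy⟩ := exists_coneRank_eq (@isOpen_univ _ (Preorder.topology _)) trivial hlt
    exact ⟨y, hy⟩

end OrdinalCone

section SheetTree

variable {T : Type w} {R : ℕ → T → T → Prop} {N k l : ℕ} {x y z : T}

/-- The union `R_k^*` of the relations `R i` with `k ≤ i`, for an infinite sequence `R` of
relations. -/
def RelGE (R : ℕ → T → T → Prop) (k : ℕ) (x y : T) : Prop := ∃ i, k ≤ i ∧ R i x y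

/-- The points `x` and `y` lie in the same `k`-sheet. -/
def SameSheet (R : ℕ → T → T → Prop) (k : ℕ) : T → T → Prop := Relation.EqvGen (RelGE R k)

/-- The `k`-sheet of the point `x`. -/
def sheet (R : ℕ → T → T → Prop) (k : ℕ) (x : T) : Set T := {y | SameSheet R k x y}

/-- The `R_k`-successors of `x`. -/
def above (R : ℕ → T → T → Prop) (k : ℕ) (x : T) : Set T := {y | R k x y}

/-- The union of the `(k + 1)`-sheet of `x` and of all `(k + 1)`-sheets that lie above it. -/
def sheetCone (R : ℕ → T → T → Prop) (k : ℕ) (x : T) : Set T := above R k x ∪ sheet R (k + 1) x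

lemma RelGE.mono (h : k ≤ l) : RelGE R l x y → RelGE R k x y :=
  fun ⟨i, hi, hr⟩ => ⟨i, h.trans hi, hr⟩

lemma RelGE.of_rel (h : R k x y) : RelGE R k x y := ⟨k, le_rfl, h⟩

lemma RelGE.rel_or_relGE_succ : RelGE R k x y → R k x y ∨ RelGE R (k + 1) x y := by
  rintro ⟨i, hi, hr⟩
  rcases hi.eq_or_lt with rfl | hlt
  · exact Or.inl hr
  · exact Or.inr ⟨i, hlt, hr⟩

namespace SameSheet

lemma refl (x : T) : SameSheet R k x x := Relation.EqvGen.refl x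

lemma symm (h : SameSheet R k x y) : SameSheet R k y x := Relation.EqvGen.symm _ _ h

lemma trans (h : SameSheet R k x y) (h' : SameSheet R k y z) : SameSheet R k x z :=
  Relation.EqvGen.trans _ _ _ h h'

lemma of_relGE (h : RelGE R k x y) : SameSheet R k x y := Relation.EqvGen.rel _ _ h

lemma of_rel (h : R k x y) : SameSheet R k x y := of_relGE (.of_rel h)

lemma mono (h : k ≤ l) (hxy : SameSheet R l x y) : SameSheet R k x y :=
  Relation.EqvGen.mono (fun _ _ => RelGE.mono h) _ _ hxy

lemma eq_of_forall_not_rel (h : ∀ i, k ≤ i → ∀ x y, ¬ R i x y) (hxy : SameSheet R k x y) :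
    x = y := by
  induction hxy with
  | rel x y hxy =>
    obtain ⟨i, hi, hr⟩ := hxy
    exact absurd hr (h i hi x y)
  | refl => rfl
  | symm _ _ _ ih => exact ih.symm
  | trans _ _ _ _ _ hxy hyz => exact hxy.trans hyz

end SameSheet

lemma sheet_eq_of_mem (h : y ∈ sheet R k x) : sheet R k y = sheet R k x :=
  Set.ext fun _ => ⟨h.trans, h.symm.trans⟩

/-- A `J`-tree, presented as an infinite sequence of relations `R k` that are empty for `N ≤ k`,
with the conditions on the tree of sheets expressed by points of the sheets. -/
structure IsSheetTree (R : ℕ → T → T → Prop) (N : ℕ) : Prop where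
  not_rel : ∀ k, N ≤ k → ∀ x y, ¬ R k x y
  irrefl : ∀ k x, ¬ R k x x
  trans : ∀ k x y z, R k x y → R k y z → R k x z
  uniform : ∀ k x x' y y', SameSheet R (k + 1) x x' → SameSheet R (k + 1) y y' →
    R k x y → R k x' y'
  linear : ∀ k x y z, R k x z → R k y z → R k x y ∨ SameSheet R (k + 1) x y ∨ R k y x
  root : ∀ k x, ∃ r, sheet R k x = sheetCone R k r

/-- `w` is a root of the set `A` of points with respect to `R_k^*`. -/
structure IsRootOf (R : ℕ → T → T → Prop) (k : ℕ) (A : Set T) (w : T) : Prop where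
  mem : w ∈ A
  relGE : ∀ v ∈ A, v ≠ w → RelGE R k w v
  not_relGE : ∀ v ∈ A, ¬ RelGE R k v w

/-- `A` is a union of `(k + 1)`-sheets and closed under `R_k`-successors. -/
structure IsSheetUpset (R : ℕ → T → T → Prop) (k : ℕ) (A : Set T) : Prop where
  above_subset : ∀ x ∈ A, above R k x ⊆ A
  sheet_subset : ∀ x ∈ A, sheet R (k + 1) x ⊆ A

lemma isSheetUpset_univ : IsSheetUpset R k Set.univ :=
  ⟨fun _ _ _ _ => trivial, fun _ _ _ _ => trivial⟩

lemma isSheetUpset_sheet (a : T) : IsSheetUpset R k (sheet R k a) :=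
  ⟨fun _ hx _ hy => hx.trans (.of_rel hy), fun _ hx _ hy => hx.trans (hy.mono k.le_succ)⟩

lemma IsSheetUpset.mem_of_relGE {A : Set T} (hA : IsSheetUpset R k A) (hx : x ∈ A)
    (h : RelGE R k x y) : y ∈ A :=
  h.rel_or_relGE_succ.elim (fun h => hA.above_subset x hx h)
    fun h => hA.sheet_subset x hx (.of_relGE h)

lemma IsSheetUpset.sheetCone_subset {A : Set T} (hA : IsSheetUpset R k A) (hx : x ∈ A) :
    sheetCone R k x ⊆ A :=
  Set.union_subset (hA.above_subset x hx) (hA.sheet_subset x hx)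

namespace IsSheetTree

variable (hT : IsSheetTree R N) {a : T}
include hT

lemma sheet_eq_singleton (hk : N ≤ k) (a : T) : sheet R k a = {a} :=
  Set.eq_singleton_iff_unique_mem.2 ⟨.refl a, fun _ h =>
    (SameSheet.eq_of_forall_not_rel (fun i hi => hT.not_rel i (hk.trans hi)) h).symm⟩

lemma above_subset_of_mem_sheet (h : x ∈ sheet R (k + 1) a) : above R k x ⊆ above R k a :=
  fun y hy => hT.uniform k x a y y h.symm (.refl y) hy

lemma isSheetUpset_above (a : T) : IsSheetUpset R k (above R k a) :=
  ⟨fun _ hx _ hy => hT.trans k _ _ _ hx hy, fun _ hx _ hy => hT.uniform k _ _ _ _ (.refl a) hy hx⟩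

lemma isSheetUpset_sheetCone (a : T) : IsSheetUpset R k (sheetCone R k a) := by
  have habove := hT.isSheetUpset_above (k := k) a
  refine ⟨fun x hx => ?_, fun x hx => ?_⟩
  · exact (hx.elim (habove.above_subset x) hT.above_subset_of_mem_sheet).trans
      Set.subset_union_left
  · rcases hx with hx | hx
    · exact (habove.sheet_subset x hx).trans Set.subset_union_left
    · exact (sheet_eq_of_mem hx).subset.trans Set.subset_union_right

lemma isSheetUpset_diff_sheetCone {A : Set T} (hA : IsSheetUpset R k A)
    (hmin : ∀ x ∈ A, ¬ R k x a) : IsSheetUpset R k (A \ sheetCone R k a) := by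
  refine ⟨fun x ⟨hxA, hxa⟩ y hxy => ⟨hA.above_subset x hxA hxy, ?_⟩,
    fun x ⟨hxA, hxa⟩ y hxy => ⟨hA.sheet_subset x hxA hxy, fun hy => ?_⟩⟩
  · rintro (hay | hay)
    · rcases hT.linear k a x y hay hxy with h | h | h
      · exact hxa (Or.inl h)
      · exact hxa (Or.inr h)
      · exact hmin x hxA h
    · exact hmin x hxA (hT.uniform k _ _ _ _ (.refl x) hay.symm hxy)
  · exact hxa ((hT.isSheetUpset_sheetCone a).sheet_subset y hy hxy.symm)

lemma disjoint_above_sheet (a : T) : Disjoint (above R k a) (sheet R (k + 1) a) :=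
  Set.disjoint_left.2 fun _ h h' => hT.irrefl k a (hT.uniform k _ _ _ _ (.refl a) h'.symm h)

lemma isRootOf_sheetCone {w : T} (hw : IsRootOf R (k + 1) (sheet R (k + 1) a) w) :
    IsRootOf R k (sheetCone R k a) w := by
  refine ⟨Or.inr hw.mem, fun v hv hne => ?_, fun v hv h => ?_⟩
  · rcases hv with h | h
    · exact .of_rel (hT.uniform k _ _ _ _ hw.mem (.refl v) h)
    · exact (hw.relGE v h hne).mono k.le_succ
  · rcases h.rel_or_relGE_succ with h | h
    · rcases hv with h' | h'
      · exact hT.irrefl k a (hT.uniform k _ _ _ _ (.refl a) hw.mem.symm (hT.trans k _ _ _ h' h))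
      · exact hT.irrefl k w (hT.uniform k _ _ _ _ (h'.symm.trans hw.mem) (.refl w) h)
    · exact hw.not_relGE v (hw.mem.trans (SameSheet.of_relGE h).symm) h

lemma exists_isRootOf_sheet (k : ℕ) (a : T) : ∃ w, IsRootOf R k (sheet R k a) w := by
  by_cases hk : N ≤ k
  · rw [hT.sheet_eq_singleton hk]
    exact ⟨a, rfl, fun v hv hne => absurd hv hne,
      fun v _ ⟨i, hi, h⟩ => hT.not_rel i (hk.trans hi) v a h⟩
  · obtain ⟨r, hr⟩ := hT.root k a
    obtain ⟨w, hw⟩ := exists_isRootOf_sheet (k + 1) r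
    exact ⟨w, hr ▸ hT.isRootOf_sheetCone hw⟩
termination_by N - k

end IsSheetTree

lemma IsRootOf.eq_of_not_relGE {A : Set T} {v w : T} (hw : IsRootOf R k A w) (hv : v ∈ A)
    (h : ∀ x ∈ A, ¬ RelGE R k x v) : v = w :=
  by_contra fun hne => h w hw.mem (hw.relGE v hv hne)

end SheetTree

section LevelMorphism

variable {T : Type w} {R : ℕ → T → T → Prop} {m : ℕ} {w : T}

/-- The last two conditions on a `J`-morphism, for the relation `R m`, at the target `w`. -/
structure IsRegularAt (R : ℕ → T → T → Prop) (m : ℕ) (τ : TopologicalSpace X) (f : X → T)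
    (w : T) : Prop where
  isOpen_relGE : IsOpen[τ] (f ⁻¹' {v | RelGE R m w v})
  isOpen_relGE_union : IsOpen[τ] (f ⁻¹' ({v | RelGE R m w v} ∪ {w}))
  isDiscrete_fiber : @IsDiscrete X τ (f ⁻¹' {w})

/-- The conditions on a `J`-morphism that concern the relation `R m`, for targets in `A`. -/
structure IsLevelMorphism (R : ℕ → T → T → Prop) (m : ℕ) (A : Set T) (τ : TopologicalSpace X)
    (f : X → T) : Prop where
  isOpenMap : @IsOpenMap X T τ (upsetTopology (R m)) f
  isRegularAt : ∀ w ∈ A, (∀ v, ¬ RelGE R (m + 1) v w) → IsRegularAt R m τ f w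

lemma IsRegularAt.comp {τ : TopologicalSpace X} {σ : TopologicalSpace Y} {g : Y → T} {r : X → Y}
    (hg : IsRegularAt R m σ g w) (hr : IsDMap τ σ r) : IsRegularAt R m τ (g ∘ r) w := by
  obtain ⟨hcont, -, hinj⟩ := isDMap_iff.1 hr
  refine ⟨hcont _ hg.isOpen_relGE, hcont _ hg.isOpen_relGE_union,
    isDiscrete_iff_isolated.2 fun x hx => ?_⟩
  obtain ⟨V, hV, hxV, hVx⟩ := isDiscrete_iff_isolated.1 hg.isDiscrete_fiber (r x) hx
  obtain ⟨U, hU, hxU, hUx⟩ := hinj x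
  exact ⟨U ∩ r ⁻¹' V, hU.inter (hcont V hV), ⟨hxU, hxV⟩,
    fun y hy e => hUx y hy.1 (hVx _ hy.2 e)⟩

lemma IsRegularAt.of_isOpenInj {Z O : Type u} {τ : TopologicalSpace Z} {f : Z → T}
    {i : O → Z} (hi : IsOpenInj τ i)
    (h : IsRegularAt R m (TopologicalSpace.induced i τ) (f ∘ i) w)
    (hsub : f ⁻¹' ({v | RelGE R m w v} ∪ {w}) ⊆ Set.range i) : IsRegularAt R m τ f w := by
  have himage {S : Set T} (hS : S ⊆ {v | RelGE R m w v} ∪ {w}) :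
      i '' ((f ∘ i) ⁻¹' S) = f ⁻¹' S :=
    Set.image_preimage_eq_of_subset ((Set.preimage_mono hS).trans hsub)
  refine ⟨?_, ?_, isDiscrete_iff_isolated.2 fun x hx => ?_⟩
  · exact himage Set.subset_union_left ▸ hi.isOpen_induced.1 h.isOpen_relGE
  · exact himage subset_rfl ▸ hi.isOpen_induced.1 h.isOpen_relGE_union
  · obtain ⟨o, rfl⟩ := hsub (Or.inr hx)
    obtain ⟨U, hU, ho, hinj⟩ := isDiscrete_iff_isolated.1 h.isDiscrete_fiber o hx
    refine ⟨i '' U, hi.isOpen_induced.1 hU, ⟨o, ho, rfl⟩, ?_⟩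
    rintro _ ⟨p, hp, rfl⟩ e
    rw [hinj p hp e]

lemma IsRootOf.preimage_relGE {A : Set T} (hw : IsRootOf R m A w) {f : X → T}
    (hf : Set.range f ⊆ A) : f ⁻¹' {v | RelGE R m w v} = (f ⁻¹' {w})ᶜ :=
  Set.ext fun x => ⟨fun h (e : f x = w) => hw.not_relGE w hw.mem (by simpa [e] using h),
    fun hne => hw.relGE (f x) (hf ⟨x, rfl⟩) hne⟩

lemma IsRootOf.isRegularAt {A : Set T} (hw : IsRootOf R m A w) {τ : TopologicalSpace X} {f : X → T}
    (hf : Set.range f ⊆ A) {x : X} (hx : f ⁻¹' {w} = {x}) (hclosed : IsClosed[τ] {x}) :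
    IsRegularAt R m τ f w := by
  refine ⟨?_, ?_, ?_⟩
  · rw [hw.preimage_relGE hf, hx]
    exact hclosed.isOpen_compl
  · rw [Set.preimage_union, hw.preimage_relGE hf, Set.compl_union_self]
    exact isOpen_univ
  · rw [hx]
    exact isDiscrete_iff_isolated.2 fun _ hy =>
      ⟨Set.univ, isOpen_univ, trivial, fun _ _ hz => hz.trans hy.symm⟩

lemma exists_mem_of_isOpenMap_comp {Z O : Type u} {τ : TopologicalSpace Z}
    {r : T → T → Prop} {f : Z → T} {i : O → Z}
    (h : @IsOpenMap O T (TopologicalSpace.induced i τ) (upsetTopology r) (f ∘ i)) {U : Set Z}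
    (hU : IsOpen[τ] U) {z : Z} (hzU : z ∈ U) (hz : z ∈ Set.range i) {t : T} (ht : r (f z) t) :
    t ∈ f '' U := by
  obtain ⟨o, rfl⟩ := hz
  obtain ⟨p, hp, e⟩ := h (i ⁻¹' U) ⟨U, hU, rfl⟩ _ ⟨o, hzU, rfl⟩ t ht
  exact ⟨i p, hp, e⟩

lemma IsLevelMorphism.comp {A : Set T} {τ : TopologicalSpace X} {σ : TopologicalSpace Y} {g : Y → T}
    {r : X → Y} (hg : IsLevelMorphism R m A σ g) (hr : IsDMap τ σ r) :
    IsLevelMorphism R m A τ (g ∘ r) :=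
  ⟨@IsOpenMap.comp X Y T r g τ σ (upsetTopology (R m)) hg.isOpenMap hr.isOpenMap,
    fun w hw hroot => (hg.isRegularAt w hw hroot).comp hr⟩

section Glue

variable {Z O₁ O₂ : Type u} {A A₁ A₂ : Set T} {τ : TopologicalSpace Z}
  {f : Z → T} {i₁ : O₁ → Z} {i₂ : O₂ → Z}

lemma IsLevelMorphism.isRegularAt_of_isOpenInj (hi : IsOpenInj τ i₁)
    (h : IsLevelMorphism R m A (TopologicalSpace.induced i₁ τ) (f ∘ i₁))
    (hsub : f ⁻¹' A ⊆ Set.range i₁) (hup : ∀ w ∈ A, ∀ v, RelGE R m w v → v ∈ A) (hw : w ∈ A)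
    (hroot : ∀ v, ¬ RelGE R (m + 1) v w) : IsRegularAt R m τ f w :=
  (h.isRegularAt w hw hroot).of_isOpenInj hi <| (Set.preimage_mono
    (Set.union_subset (hup w hw) (Set.singleton_subset_iff.2 hw))).trans hsub

theorem IsLevelMorphism.union (hi₁ : IsOpenInj τ i₁) (hi₂ : IsOpenInj τ i₂)
    (h₁ : IsLevelMorphism R m A₁ (TopologicalSpace.induced i₁ τ) (f ∘ i₁))
    (h₂ : IsLevelMorphism R m A₂ (TopologicalSpace.induced i₂ τ) (f ∘ i₂))
    (hsub₁ : f ⁻¹' A₁ ⊆ Set.range i₁) (hsub₂ : f ⁻¹' A₂ ⊆ Set.range i₂)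
    (hf : Set.range f ⊆ A₁ ∪ A₂) (hup₁ : ∀ w ∈ A₁, ∀ v, RelGE R m w v → v ∈ A₁)
    (hup₂ : ∀ w ∈ A₂, ∀ v, RelGE R m w v → v ∈ A₂) : IsLevelMorphism R m (A₁ ∪ A₂) τ f := by
  refine ⟨?_, fun w hw hroot => ?_⟩
  · rintro U hU _ ⟨x, hx, rfl⟩ t ht
    rcases hf ⟨x, rfl⟩ with h | h
    · exact exists_mem_of_isOpenMap_comp h₁.isOpenMap hU hx (hsub₁ h) ht
    · exact exists_mem_of_isOpenMap_comp h₂.isOpenMap hU hx (hsub₂ h) ht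
  · rcases hw with hw | hw
    · exact h₁.isRegularAt_of_isOpenInj hi₁ hsub₁ hup₁ hw hroot
    · exact h₂.isRegularAt_of_isOpenInj hi₂ hsub₂ hup₂ hw hroot

lemma exists_glue (hi₁ : Function.Injective i₁) (hi₂ : Function.Injective i₂)
    (hc : IsCompl (Set.range i₁) (Set.range i₂)) (f₁ : O₁ → T) (f₂ : O₂ → T)
    (hd : Disjoint (Set.range f₁) (Set.range f₂)) :
    ∃ f : Z → T, f ∘ i₁ = f₁ ∧ f ∘ i₂ = f₂ ∧ f ⁻¹' Set.range f₁ = Set.range i₁ ∧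
      f ⁻¹' Set.range f₂ = Set.range i₂ ∧ Set.range f = Set.range f₁ ∪ Set.range f₂ := by
  have hcover : Set.range i₁ ∪ Set.range i₂ = Set.univ := hc.sup_eq_top
  let e : O₁ ⊕ O₂ ≃ Z := Equiv.ofBijective (Sum.elim i₁ i₂)
    ⟨hi₁.sumElim hi₂ (Set.disjoint_range_iff.1 hc.disjoint),
      Set.range_eq_univ.1 (Set.Sum.elim_range i₁ i₂ ▸ hcover)⟩
  obtain ⟨f, hf⟩ : ∃ f : Z → T, f ∘ e = Sum.elim f₁ f₂ :=
    ⟨Sum.elim f₁ f₂ ∘ e.symm, by simp [Function.comp_assoc]⟩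
  have hf₁ (o : O₁) : f (i₁ o) = f₁ o := congrFun hf (Sum.inl o)
  have hf₂ (o : O₂) : f (i₂ o) = f₂ o := congrFun hf (Sum.inr o)
  refine ⟨f, funext hf₁, funext hf₂, ?_, ?_, ?_⟩
  · ext z
    obtain ⟨o | o, rfl⟩ := e.surjective z
    · exact iff_of_true ⟨o, (hf₁ o).symm⟩ ⟨o, rfl⟩
    · exact iff_of_false (fun h => hd.notMem_of_mem_right ⟨o, (hf₂ o).symm⟩ h)
        (hc.disjoint.notMem_of_mem_right ⟨o, rfl⟩)
  · ext z
    obtain ⟨o | o, rfl⟩ := e.surjective z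
    · exact iff_of_false (fun h => hd.notMem_of_mem_left ⟨o, (hf₁ o).symm⟩ h)
        (hc.disjoint.notMem_of_mem_left ⟨o, rfl⟩)
    · exact iff_of_true ⟨o, (hf₂ o).symm⟩ ⟨o, rfl⟩
  · rw [← e.surjective.range_comp f, hf, Set.Sum.elim_range]

end Glue

lemma IsSheetTree.isLevelMorphism_sheetCone {N k : ℕ} (hT : IsSheetTree R N) {Z : Type u}
    {τ : TopologicalSpace Z} {C : Set Z} (hC : IsOpenInj τ (Subtype.val : ↥Cᶜ → Z)) {a : T}
    {f : Z → T} (h : IsLevelMorphism R k (above R k a) (TopologicalSpace.induced Subtype.val τ)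
      (f ∘ (Subtype.val : ↥Cᶜ → Z)))
    (hpre : f ⁻¹' above R k a = Cᶜ) (hf : Set.range f ⊆ sheetCone R k a)
    (hbase : ∀ x ∈ C, ∀ U, IsOpen[τ] U → x ∈ U → above R k a ⊆ f '' U)
    (hw : IsRootOf R (k + 1) (sheet R (k + 1) a) w) {x : Z} (hx : f ⁻¹' {w} = {x})
    (hclosed : IsClosed[τ] {x}) : IsLevelMorphism R k (sheetCone R k a) τ f := by
  refine ⟨?_, fun v hv hroot => ?_⟩
  · rintro U hU _ ⟨z, hz, rfl⟩ t ht
    by_cases hzC : z ∈ C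
    · have hza : f z ∈ sheet R (k + 1) a :=
        (hf ⟨z, rfl⟩).resolve_left fun h => (hpre.subset h) hzC
      exact hbase z hzC U hU hz (hT.above_subset_of_mem_sheet hza ht)
    · exact exists_mem_of_isOpenMap_comp h.isOpenMap hU hz (Subtype.range_coe.superset hzC) ht
  · rcases hv with hv | hv
    · exact h.isRegularAt_of_isOpenInj hC (by rw [hpre, Subtype.range_coe])
        (fun _ hw _ => (hT.isSheetUpset_above a).mem_of_relGE hw) hv hroot
    · rw [hw.eq_of_not_relGE hv fun y _ => hroot y]
      exact (hT.isRootOf_sheetCone hw).isRegularAt hf hx hclosed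

end LevelMorphism

lemma IsLMESeq.of_subsingleton [Subsingleton X] (base : TopologicalSpace X)
    (τ : ℕ → TopologicalSpace X) : IsLMESeq base τ := by
  have h (σ σ' : TopologicalSpace X) : IsLMaximalLExtension σ σ' :=
    ⟨Subsingleton.elim σ σ' ▸ IsLExtension.refl σ, fun _ _ => Subsingleton.elim _ _⟩
  refine ⟨fun A ⟨x, hx⟩ => ⟨x, hx, Set.univ, isOpen_univ, ?_⟩, h _ _, fun _ => h _ _⟩
  rw [Set.univ_inter, Set.eq_singleton_iff_unique_mem]
  exact ⟨hx, fun _ _ => Subsingleton.elim _ _⟩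

lemma IsDMap.id (τ : TopologicalSpace X) : IsDMap τ τ id :=
  isDMap_iff.2 ⟨fun _ hV => hV, fun _ hU => by rwa [Set.image_id],
    fun _ => ⟨Set.univ, isOpen_univ, trivial, fun _ _ e => e⟩⟩

lemma IsCone.surjective {Z Y : Type u} {τ : TopologicalSpace Z} {σ : TopologicalSpace Y} {C : Set Z}
    {c : ↥Cᶜ → Y} (hC : IsCone τ σ C c) (hne : C.Nonempty) : Function.Surjective c := by
  intro y
  obtain ⟨x, hx⟩ := hne
  obtain ⟨o, -, ho⟩ := hC.exists_fiber x hx Set.univ isOpen_univ trivial y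
  exact ⟨o, ho⟩

lemma isClosed_singleton_Icc {lam : Ordinal.{u}} {τ : TopologicalSpace (Set.Icc 1 lam)}
    (hτ : τ ≤ Preorder.topology _) (x : Set.Icc 1 lam) : IsClosed[τ] {x} := by
  refine IsClosed.mono ?_ hτ
  let _ := Preorder.topology (Set.Icc 1 lam)
  have : OrderTopology (Set.Icc 1 lam) := ⟨rfl⟩
  exact isClosed_singleton

lemma isCompl_range_shift (l₁ l₂ : Ordinal.{u}) :
    IsCompl (Set.range (shift (a := 0) (μ := l₁) (lam := l₁ + l₂) (by simp)))
      (Set.range (shift (le_refl (l₁ + l₂)))) := by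
  rw [range_shift, range_shift, zero_add]
  refine ⟨Set.disjoint_left.2 fun x hx hx' => hx'.1.not_ge hx.2, codisjoint_iff.2 ?_⟩
  refine Set.eq_univ_of_forall fun x => ?_
  exact (le_or_gt x.1 l₁).imp (fun h => ⟨zero_lt_one.trans_le x.2.1, h⟩) fun h => ⟨h, x.2.2⟩

section Realization

variable {T : Type w} {R : ℕ → T → T → Prop} {N k : ℕ} {A A₁ A₂ : Set T} {w a : T}

/-- `f` is a morphism from the ordinal lme-space `([1, lam], τ 0, τ 1, …)` onto `A`, with respect
to the relations `R k, R (k + 1), …`. If `A` has a root, it is taken at the last point only, so that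
it keeps a closed one-point fibre when `[1, lam]` becomes the base of a cone. -/
structure IsRealization (R : ℕ → T → T → Prop) (k : ℕ) (A : Set T) (lam : Ordinal.{u})
    (τ : ℕ → TopologicalSpace (Set.Icc 1 lam)) (f : Set.Icc 1 lam → T) : Prop where
  isLMESeq : IsLMESeq (Preorder.topology _) τ
  isLevelMorphism : ∀ j, IsLevelMorphism R (k + j) A (τ j) f
  range_eq : Set.range f = A
  eq_of_isRootOf : ∀ w, IsRootOf R k A w → ∀ x, f x = w → x.1 = lam

/-- The set `A` is the image of an ordinal lme-space of length less than `ε₀` under a morphism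
with respect to the relations `R k, R (k + 1), …`. -/
def Realizes (R : ℕ → T → T → Prop) (k : ℕ) (A : Set T) : Prop :=
  ∃ lam : Ordinal.{u}, lam < ε₀ ∧ ∃ τ f, IsRealization R k A lam τ f

lemma IsRealization.eq_iff {lam : Ordinal.{u}} {τ : ℕ → TopologicalSpace (Set.Icc 1 lam)}
    {f : Set.Icc 1 lam → T} (h : IsRealization R k A lam τ f) (hw : IsRootOf R k A w)
    {x : Set.Icc 1 lam} : f x = w ↔ x.1 = lam := by
  refine ⟨h.eq_of_isRootOf w hw x, fun hx => ?_⟩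
  obtain ⟨y, rfl⟩ := h.range_eq.superset hw.mem
  exact congrArg f (Subtype.ext (hx.trans (h.eq_of_isRootOf _ hw y rfl).symm))

lemma realizes_empty (k : ℕ) : Realizes.{u} R k ∅ := by
  have : IsEmpty (Set.Icc 1 (0 : Ordinal.{u})) := by simp
  refine ⟨0, Ordinal.epsilon_pos 0, fun _ => Preorder.topology _, isEmptyElim,
    .of_subsingleton _ _, fun j => ⟨?_, fun _ hw => hw.elim⟩, Set.range_eq_empty _,
    fun _ _ => isEmptyElim⟩
  rintro U - _ ⟨x, -⟩
  exact isEmptyElim x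

lemma realizes_singleton (hR : ∀ i, k ≤ i → ∀ x y, ¬ R i x y) (a : T) : Realizes.{u} R k {a} := by
  have : Unique (Set.Icc 1 (1 : Ordinal.{u})) := by
    rw [Set.Icc_self]
    exact Set.uniqueSingleton 1
  have hnot (j : ℕ) (x y : T) : ¬ RelGE R (k + j) x y :=
    fun ⟨i, hi, h⟩ => hR i (le_self_add.trans hi) x y h
  have hrange : Set.range (fun _ : Set.Icc 1 (1 : Ordinal.{u}) => a) = {a} := Set.range_const
  refine ⟨1, by simpa using Ordinal.natCast_lt_epsilon 1 0, fun _ => Preorder.topology _,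
    fun _ => a, .of_subsingleton _ _, fun j => ⟨?_, ?_⟩, hrange,
    fun _ _ x _ => le_antisymm x.2.2 x.2.1⟩
  · rintro U - _ ⟨x, -, rfl⟩ t ht
    exact absurd (.of_rel ht) (hnot j a t)
  · rintro w rfl -
    have hw : IsRootOf R (k + j) {w} w :=
      ⟨rfl, fun v hv hne => absurd hv hne, fun v _ => hnot j v w⟩
    exact hw.isRegularAt hrange.subset (x := default)
      (Set.ext fun x => iff_of_true rfl (Subsingleton.elim x _))
      (isClosed_singleton_Icc le_rfl _)

lemma not_isRootOf_union (hne : A₂.Nonempty) (hd : Disjoint A₁ A₂)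
    (hA₁ : ∀ x ∈ A₁, ∀ y, RelGE R k x y → y ∈ A₁) (hw : IsRootOf R k (A₁ ∪ A₂) w) : w ∉ A₁ := by
  intro hwA
  obtain ⟨v, hv⟩ := hne
  have hvw : v ≠ w := fun e => Set.disjoint_left.1 hd hwA (e ▸ hv)
  exact Set.disjoint_left.1 hd (hA₁ w hwA v (hw.relGE v (Or.inr hv) hvw)) hv

lemma Realizes.union (h₁ : Realizes.{u} R k A₁) (h₂ : Realizes.{u} R k A₂)
    (hne₁ : A₁.Nonempty) (hne₂ : A₂.Nonempty) (hd : Disjoint A₁ A₂)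
    (hA₁ : ∀ x ∈ A₁, ∀ y, RelGE R k x y → y ∈ A₁)
    (hA₂ : ∀ x ∈ A₂, ∀ y, RelGE R k x y → y ∈ A₂) : Realizes.{u} R k (A₁ ∪ A₂) := by
  obtain ⟨l₁, hl₁, υ₁, f₁, hυ₁, hf₁, rfl, -⟩ := h₁
  obtain ⟨l₂, hl₂, υ₂, f₂, hυ₂, hf₂, rfl, -⟩ := h₂
  let i₁ : Set.Icc 1 l₁ → Set.Icc 1 (l₁ + l₂) := shift (a := 0) (by simp)
  let i₂ : Set.Icc 1 l₂ → Set.Icc 1 (l₁ + l₂) := shift (a := l₁) le_rfl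
  have hi₁ : IsOpenInj (Preorder.topology _) i₁ := isOpenInj_shift _
  have hi₂ : IsOpenInj (Preorder.topology _) i₂ := isOpenInj_shift _
  have hcompl : IsCompl (Set.range i₁) (Set.range i₂) := isCompl_range_shift l₁ l₂
  obtain ⟨σ, hσ, hd₁, hd₂⟩ := exists_isLMESeq_lift (isScattered_Icc (l₁ + l₂)) hi₁ hi₂
    hcompl.disjoint (r₁ := id) (r₂ := id) (by rw [induced_shift]; exact .id _)
    (by rw [induced_shift]; exact .id _) hυ₁ hυ₂
  obtain ⟨f, hfi₁, hfi₂, hpre₁, hpre₂, hrange⟩ := exists_glue hi₁.inj hi₂.inj hcompl f₁ f₂ hd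
  refine ⟨l₁ + l₂, isPrincipal_add_epsilon 0 hl₁ hl₂, σ, f, hσ, fun j => ?_, hrange, ?_⟩
  · refine .union (hi₁.mono (hσ.le_base j)) (hi₂.mono (hσ.le_base j)) ?_ ?_
      hpre₁.subset hpre₂.subset hrange.subset (fun x hx y hxy => hA₁ x hx y (hxy.mono le_self_add))
      fun x hx y hxy => hA₂ x hx y (hxy.mono le_self_add)
    · rw [hfi₁]
      exact (hf₁ j).comp (hd₁ j)
    · rw [hfi₂]
      exact (hf₂ j).comp (hd₂ j)
  · intro w hw
    rcases hw.mem with h | h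
    · exact absurd h (not_isRootOf_union hne₂ hd hA₁ hw)
    · exact absurd h (not_isRootOf_union hne₁ hd.symm hA₂ (Set.union_comm _ _ ▸ hw))

section Cone

variable {μ κ : Ordinal.{u}} {f : Set.Icc 1 (coneLength μ κ) → T}

lemma preimage_singleton_eq_coneApex {g : Set.Icc 1 (1 + κ) → T}
    (hf : f ∘ (Subtype.val : coneBase μ κ → _) = g ∘ coneRank) (hsub : f ⁻¹' {w} ⊆ coneBase μ κ)
    (hw : ∀ x, g x = w ↔ x.1 = 1 + κ) : f ⁻¹' {w} = {(coneApex μ κ).1} := by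
  have hf' (x : coneBase μ κ) : f x.1 = w ↔ x.1.1 = coneLength μ κ := by
    rw [← coneRank_eq_iff, ← hw]
    exact Eq.congr_left (congrFun hf x)
  refine Set.eq_singleton_iff_unique_mem.2 ⟨(hf' (coneApex μ κ)).2 rfl, fun x hx => ?_⟩
  exact Subtype.ext ((hf' ⟨x, hsub hx⟩).1 hx)

lemma isRealization_cone (hT : IsSheetTree R N) {υ : ℕ → TopologicalSpace (Set.Icc 1 μ)}
    {θ : ℕ → TopologicalSpace (Set.Icc 1 (1 + κ))} {τ : ℕ → TopologicalSpace _}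
    {g₁ : Set.Icc 1 μ → T} {g₂ : Set.Icc 1 (1 + κ) → T}
    (h₁ : IsRealization R k (above R k a) μ υ g₁)
    (h₂ : IsRealization R (k + 1) (sheet R (k + 1) a) (1 + κ) θ g₂)
    (hτ : IsLMESeq (Preorder.topology _) τ) (hC : IsCone (τ 0) (υ 0) (coneBase μ κ) coneFold)
    (hfold : ∀ j, IsDMap (TopologicalSpace.induced Subtype.val (τ j)) (υ j)
      (coneFold (μ := μ) (κ := κ)))
    (hbase : ∀ j, IsOpenInj (τ (j + 1)) (Subtype.val : coneBase μ κ → _))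
    (hrank : ∀ j, IsDMap (TopologicalSpace.induced Subtype.val (τ (j + 1))) (θ j)
      (coneRank (μ := μ) (κ := κ)))
    (hf₁ : f ∘ Subtype.val = g₁ ∘ coneFold) (hf₂ : f ∘ Subtype.val = g₂ ∘ coneRank)
    (hpre₁ : f ⁻¹' above R k a = (coneBase μ κ)ᶜ)
    (hpre₂ : f ⁻¹' sheet R (k + 1) a = coneBase μ κ) (hrange : Set.range f = sheetCone R k a) :
    IsRealization R k (sheetCone R k a) (coneLength μ κ) τ f := by
  obtain ⟨w, hw⟩ := hT.exists_isRootOf_sheet (k + 1) a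
  have hapex : f ⁻¹' {w} = {(coneApex μ κ).1} := preimage_singleton_eq_coneApex hf₂
    ((Set.preimage_mono (Set.singleton_subset_iff.2 hw.mem)).trans hpre₂.subset)
    fun _ => h₂.eq_iff hw
  have habove (j : ℕ) : IsLevelMorphism R (k + j) (above R k a)
      (TopologicalSpace.induced Subtype.val (τ j)) (f ∘ Subtype.val) :=
    hf₁ ▸ (h₁.isLevelMorphism j).comp (hfold j)
  refine ⟨hτ, fun j => ?_, hrange, fun v hv x hx => ?_⟩
  · cases j with
    | zero =>
      refine hT.isLevelMorphism_sheetCone hC.isOpenInj_compl (habove 0) hpre₁ hrange.subset ?_ hw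
        hapex (isClosed_singleton_Icc (hτ.le_base 0) _)
      intro x hx U hU hxU t ht
      obtain ⟨y, rfl⟩ := h₁.range_eq.superset ht
      obtain ⟨o, hoU, rfl⟩ := hC.exists_fiber x hx U hU hxU y
      exact ⟨o, hoU, congrFun hf₁ o⟩
    | succ j =>
      refine .union (isOpenInj_compl_coneBase.mono (hτ.le_base _)) (hbase j) (habove (j + 1))
        (hf₂ ▸ ?_) (by rw [hpre₁, Subtype.range_coe]) (by rw [hpre₂, Subtype.range_coe])
        hrange.subset
        (fun x hx y hxy => (hT.isSheetUpset_above a).mem_of_relGE hx (hxy.mono le_self_add))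
        fun x hx y hxy => hx.trans (.of_relGE (hxy.mono (by omega)))
      rw [← add_assoc, add_right_comm]
      exact (h₂.isLevelMorphism j).comp (hrank j)
  · have hroot := hT.isRootOf_sheetCone hw
    obtain rfl := hroot.eq_of_not_relGE hv.mem hv.not_relGE
    exact congrArg Subtype.val (hapex.subset hx)

end Cone

lemma Realizes.cone (hT : IsSheetTree R N) (a : T) (h₁ : Realizes.{u} R k (above R k a))
    (h₂ : Realizes.{u} R (k + 1) (sheet R (k + 1) a)) : Realizes.{u} R k (sheetCone R k a) := by
  obtain ⟨μ, hμ, υ, g₁, hg₁⟩ := h₁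
  obtain ⟨lam, hlam, θ, g₂, hg₂⟩ := h₂
  obtain ⟨x, -⟩ := hg₂.range_eq.superset (SameSheet.refl a)
  obtain ⟨κ, rfl⟩ : ∃ κ, 1 + κ = lam := ⟨_, Ordinal.add_sub_cancel_of_le (x.2.1.trans x.2.2)⟩
  obtain ⟨τ, hτ, hC, hfold, hrank⟩ := isCone_coneBase.exists_isLMESeq (compactSpace_Icc μ)
    isRankFn_coneRank hg₁.isLMESeq hg₂.isLMESeq
  have hrange₁ : Set.range (g₁ ∘ coneFold (κ := κ)) = above R k a := by
    rw [(hC.surjective ⟨_, (coneApex μ κ).2⟩).range_comp, hg₁.range_eq]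
  have hrange₂ : Set.range (g₂ ∘ coneRank (μ := μ)) = sheet R (k + 1) a := by
    rw [surjective_coneRank.range_comp, hg₂.range_eq]
  obtain ⟨f, hf₁, hf₂, hpre₁, hpre₂, hrange⟩ := exists_glue
    (i₁ := (Subtype.val : ↥(coneBase μ κ)ᶜ → _)) (i₂ := (Subtype.val : coneBase μ κ → _))
    Subtype.val_injective Subtype.val_injective
    (by simpa only [Subtype.range_coe] using isCompl_compl.symm) (g₁ ∘ coneFold) (g₂ ∘ coneRank)
    (by rw [hrange₁, hrange₂]; exact hT.disjoint_above_sheet a)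
  rw [hrange₁, Subtype.range_coe] at hpre₁
  rw [hrange₂, Subtype.range_coe] at hpre₂
  rw [hrange₁, hrange₂] at hrange
  exact ⟨coneLength μ κ, coneLength_lt_epsilon hμ (le_add_self.trans_lt hlam), τ, f,
    isRealization_cone hT hg₁ hg₂ hτ hC hfold (fun j => (hrank j).1) (fun j => (hrank j).2) hf₁ hf₂
      hpre₁ hpre₂ hrange⟩

section Finite

variable [Finite T]

lemma IsSheetTree.exists_forall_not_rel (hT : IsSheetTree R N) (k : ℕ) (hne : A.Nonempty) :
    ∃ a ∈ A, ∀ x ∈ A, ¬ R k x a := by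
  have : Std.Irrefl (R k) := ⟨hT.irrefl k⟩
  have : IsTrans T (R k) := ⟨hT.trans k⟩
  exact (Finite.wellFounded_of_trans_of_irrefl (R k)).has_min A hne

/-- Induction on the size of `A`: take an `R k`-minimal point `a` of `A`. If `A` is the cone of `a`,
then it is realized by the cone over a realization of the points above `a`, and otherwise the cone
and its complement in `A` are smaller upsets. -/
theorem realizes_of_isSheetUpset (hT : IsSheetTree R N)
    (hsheet : ∀ a, Realizes.{u} R (k + 1) (sheet R (k + 1) a)) (hA : IsSheetUpset R k A) :
    Realizes.{u} R k A := by
  induction hn : A.ncard using Nat.strong_induction_on generalizing A with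
  | _ n ih =>
    subst hn
    replace ih {B : Set T} (hB : IsSheetUpset R k B) (hlt : B ⊂ A) : Realizes.{u} R k B :=
      ih _ (Set.ncard_lt_ncard hlt A.toFinite) hB rfl
    rcases A.eq_empty_or_nonempty with rfl | hne
    · exact realizes_empty k
    obtain ⟨a, ha, hmin⟩ := hT.exists_forall_not_rel k hne
    have hBA := hA.sheetCone_subset ha
    have haB : a ∈ sheetCone R k a := Or.inr (.refl a)
    rcases hBA.eq_or_ssubset with rfl | hlt
    · refine .cone hT a (ih (hT.isSheetUpset_above a) ?_) (hsheet a)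
      exact ⟨Set.subset_union_left, fun h => hT.irrefl k a (h haB)⟩
    · have hB := hT.isSheetUpset_sheetCone (k := k) a
      have hD := hT.isSheetUpset_diff_sheetCone hA hmin
      rw [← Set.union_sdiff_cancel hBA]
      exact .union (ih hB hlt) (ih hD ⟨Set.sdiff_subset, fun h => (h ha).2 haB⟩) ⟨a, haB⟩
        (Set.sdiff_nonempty.2 hlt.not_subset) Set.disjoint_sdiff_right
        (fun _ hx _ => hB.mem_of_relGE hx) fun _ hx _ => hD.mem_of_relGE hx

theorem realizes_sheet (hT : IsSheetTree R N) (k : ℕ) (a : T) :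
    Realizes.{u} R k (sheet R k a) := by
  by_cases hk : N ≤ k
  · rw [hT.sheet_eq_singleton hk]
    exact realizes_singleton (fun i hi => hT.not_rel i (hk.trans hi)) a
  · exact realizes_of_isSheetUpset hT (realizes_sheet hT (k + 1)) (isSheetUpset_sheet a)
termination_by N - k

theorem realizes_univ (hT : IsSheetTree R N) (k : ℕ) : Realizes.{u} R k Set.univ :=
  realizes_of_isSheetUpset hT (realizes_sheet hT (k + 1)) isSheetUpset_univ

end Finite

end Realization

section Assembly

variable {T : Type w} {n k : ℕ} {R : Fin (n + 1) → T → T → Prop}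

/-- The family `R`, extended by empty relations to an infinite sequence. -/
def extendRel (R : Fin (n + 1) → T → T → Prop) (k : ℕ) (x y : T) : Prop :=
  ∃ h : k < n + 1, R ⟨k, h⟩ x y

lemma extendRel_val (k : Fin (n + 1)) : extendRel R k = R k :=
  funext₂ fun _ _ => propext ⟨fun ⟨_, h⟩ => h, fun h => ⟨k.2, h⟩⟩

lemma relGE_extendRel (k : ℕ) : RelGE (extendRel R) k = RStar R k :=
  funext₂ fun _ _ => propext
    ⟨fun ⟨i, hi, h, hr⟩ => ⟨⟨i, h⟩, hi, hr⟩, fun ⟨i, hi, hr⟩ => ⟨i, hi, i.2, hr⟩⟩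

lemma isSheet_sheet (k : ℕ) (x : T) : IsSheet R k (sheet (extendRel R) k x) :=
  ⟨x, by rw [sheet, SameSheet, relGE_extendRel]⟩

lemma isHereditaryRoot_iff {w : T} :
    IsHereditaryRoot R k w ↔ ∀ v, ¬ RelGE (extendRel R) k v w := by
  rw [relGE_extendRel]
  exact ⟨fun h v ⟨j, hj, hr⟩ => h j hj v hr, fun h j hj v hr => h v ⟨j, hj, hr⟩⟩

namespace IsJTree

variable (hT : IsJTree R)
include hT

lemma rel_of_sheetRel {k : Fin (n + 1)} {x y : T}
    (h : SheetRel R k (sheet (extendRel R) (k + 1) x) (sheet (extendRel R) (k + 1) y)) :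
    R k x y :=
  hT.uniform k _ _ (isSheet_sheet _ x) (isSheet_sheet _ y) h x (.refl x) y (.refl y)

lemma isTreeUnder_sheets (k : Fin (n + 1)) (x : T) : IsTreeUnder
    {A | IsSheet R (k + 1) A ∧ A ⊆ sheet (extendRel R) k x} (SheetRel R k) :=
  hT.tree k _ (isSheet_sheet k x)

lemma exists_sheet_eq_sheetCone (k : Fin (n + 1)) (x : T) :
    ∃ r, sheet (extendRel R) k x = sheetCone (extendRel R) k r := by
  obtain ⟨_, ⟨⟨r, rfl⟩, hrx⟩, hmin⟩ := (hT.isTreeUnder_sheets k x).root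
  simp only [← relGE_extendRel] at hrx hmin
  have hr : r ∈ sheet (extendRel R) k x := hrx (SameSheet.refl r)
  refine ⟨r, subset_antisymm (fun y hy => ?_) ((isSheetUpset_sheet x).sheetCone_subset hr)⟩
  rcases hmin (sheet (extendRel R) (k + 1) y)
    ⟨isSheet_sheet _ y, (isSheetUpset_sheet x).sheet_subset y hy⟩ with h | h
  · exact Or.inr (h.subset (SameSheet.refl y))
  · exact Or.inl ⟨k.2, hT.rel_of_sheetRel h⟩

lemma rel_or_sameSheet_or_rel (k : Fin (n + 1)) {x y z : T} (hx : R k x z) (hy : R k y z) :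
    R k x y ∨ SameSheet (extendRel R) (k + 1) x y ∨ R k y x := by
  have hmem {v : T} (hv : v ∈ sheet (extendRel R) k z) : sheet (extendRel R) (k + 1) v ∈
      {A | IsSheet R (k + 1) A ∧ A ⊆ sheet (extendRel R) k z} :=
    ⟨isSheet_sheet _ v, (isSheetUpset_sheet z).sheet_subset v hv⟩
  have hbelow {v : T} (hv : R k v z) : v ∈ sheet (extendRel R) k z :=
    (SameSheet.of_rel (R := extendRel R) ⟨k.2, hv⟩).symm
  have hrel {v : T} (hv : R k v z) :
      SheetRel R k (sheet (extendRel R) (k + 1) v) (sheet (extendRel R) (k + 1) z) :=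
    ⟨v, .refl v, z, .refl z, hv⟩
  exact ((hT.isTreeUnder_sheets k z).linear _ (hmem (hbelow hx)) _ (hmem (hbelow hy)) _
    (hmem (SameSheet.refl z)) (hrel hx) (hrel hy)).imp hT.rel_of_sheetRel
      (.imp (fun h => h.superset (SameSheet.refl y)) hT.rel_of_sheetRel)

theorem isSheetTree : IsSheetTree (extendRel R) (n + 1) where
  not_rel k hk _ _ h := absurd h.1 hk.not_gt
  irrefl _ x := fun ⟨_, h⟩ => (hT.dually_wf _).irrefl.irrefl x h
  trans _ _ _ _ := fun ⟨hk, h⟩ ⟨_, h'⟩ => ⟨hk, hT.trans _ _ _ _ h h'⟩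
  uniform k x x' y y' hx hy := fun ⟨hk, h⟩ => ⟨hk, hT.uniform ⟨k, hk⟩ _ _ (isSheet_sheet _ x)
    (isSheet_sheet _ y) ⟨x, .refl x, y, .refl y, h⟩ x' hx y' hy⟩
  linear k x y z := fun ⟨hk, hx⟩ ⟨_, hy⟩ => by
    rcases hT.rel_or_sameSheet_or_rel ⟨k, hk⟩ hx hy with h | h | h
    · exact Or.inl ⟨hk, h⟩
    · exact Or.inr (Or.inl h)
    · exact Or.inr (Or.inr ⟨hk, h⟩)
  root k x := by
    by_cases hk : k < n + 1
    · exact hT.exists_sheet_eq_sheetCone ⟨k, hk⟩ x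
    · have hempty (i : ℕ) (hi : k ≤ i) (y z : T) : ¬ extendRel R i y z :=
        fun h => hk (hi.trans_lt h.1)
      refine ⟨x, subset_antisymm (fun y hy => ?_)
        ((isSheetUpset_sheet x).sheetCone_subset (.refl x))⟩
      rw [SameSheet.eq_of_forall_not_rel hempty hy]
      exact Or.inr (.refl y)

end IsJTree

section LMESeq

variable {base : TopologicalSpace X} {τ : ℕ → TopologicalSpace X} {f : X → T}

lemma IsLMESeq.isLMESpace (h : IsLMESeq base τ) : IsLMESpace base fun k : Fin (n + 1) => τ k :=
  ⟨h.scattered_base, h.zero, fun k => h.succ k⟩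

lemma IsLMESeq.isGLPSpace (h : IsLMESeq base τ) : IsGLPSpace fun k : Fin (n + 1) => τ k :=
  ⟨fun k => h.isScattered k, fun k U hU => h.succ_le k U (nextTopology_le _ U hU),
    fun k A => h.succ_le k _ (isOpen_nextTopology_derivedSet _ A)⟩

lemma continuous_of_isOpen_preimage {τ : TopologicalSpace X} {r : T → T → Prop}
    (h : ∀ w, IsOpen[τ] (f ⁻¹' ({v | r w v} ∪ {w}))) : Continuous[τ, upsetTopology r] f := by
  refine continuous_def.2 fun V hV => isOpen_of_forall_exists_subset fun x hx => ?_
  refine ⟨_, h (f x), Or.inr rfl, Set.preimage_mono (Set.union_subset (hV (f x) hx) ?_)⟩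
  exact Set.singleton_subset_iff.2 hx

theorem isJMorphism_of_isLevelMorphism (hτ : IsLMESeq base τ)
    (hf : ∀ k, IsLevelMorphism (extendRel R) k Set.univ (τ k) f) :
    IsJMorphism (fun k : Fin (n + 1) => τ k) R f := by
  have hreg (k : ℕ) (w : T) (hw : IsHereditaryRoot R (k + 1) w) :
      IsRegularAt (extendRel R) k (τ k) f w :=
    (hf k).isRegularAt w trivial (isHereditaryRoot_iff.1 hw)
  have hopen (k : Fin (n + 1)) : @IsOpenMap X T (τ k) (upsetTopology (R k)) f := by
    rw [← extendRel_val (R := R) k]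
    exact (hf k).isOpenMap
  have hlast (w : T) : IsHereditaryRoot R (n + 1) w := fun j hj => absurd j.2 hj.not_gt
  have hR : RelGE (extendRel R) n = R (Fin.last n) := by
    refine funext₂ fun _ _ => propext
      ⟨fun ⟨i, hi, hin, h⟩ => ?_, fun h => ⟨n, le_rfl, n.lt_succ_self, h⟩⟩
    obtain rfl := le_antisymm (Nat.lt_succ_iff.1 hin) hi
    exact h
  refine ⟨hτ.isGLPSpace, ⟨continuous_of_isOpen_preimage fun w => ?_, hopen _,
    fun w => (hreg n w (hlast w)).isDiscrete_fiber⟩, hopen, fun k w hw => ?_,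
    fun k w hw => (hreg k w hw).isDiscrete_fiber⟩
  · exact hR ▸ (hreg n w (hlast w)).isOpen_relGE_union
  · rw [← relGE_extendRel]
    exact ⟨(hreg k w hw).isOpen_relGE, (hreg k w hw).isOpen_relGE_union⟩

end LMESeq

end Assembly

end GLPSpaces

theorem mainTheorem3 {n : ℕ} {T : Type v} [Finite T] (R : Fin (n + 1) → T → T → Prop)
    (hT : GLPSpaces.IsJTree R) :
    ∃ lam : Ordinal.{0}, lam < ε₀ ∧
      ∃ (τ : Fin (n + 1) → TopologicalSpace (Set.Icc 1 lam)) (f : Set.Icc 1 lam → T),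
        GLPSpaces.IsOrdinalLMESpace lam τ ∧ GLPSpaces.IsJMorphism τ R f ∧
        Function.Surjective f := by
  obtain ⟨lam, hlam, τ, f, hf⟩ := GLPSpaces.realizes_univ.{0} hT.isSheetTree 0
  refine ⟨lam, hlam, fun k => τ k, f, hf.isLMESeq.isLMESpace,
    GLPSpaces.isJMorphism_of_isLevelMorphism hf.isLMESeq fun k => ?_,
    Set.range_eq_univ.1 hf.range_eq⟩
  simpa only [zero_add] using hf.isLevelMorphism k
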